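/- A virtual knot (respectively, long virtual knot) is an equivalence class of oriented virtual knot diagrams (respectively, long virtual knot diagrams) under the generalized Reidemeister moves; equivalently, an equivalence class of Gauss diagrams on an oriented circle (respectively, line) under the Reidemeister moves of Gauss diagrams. It is called classical if it has a diagram without virtual crossings. A function $v$ from the set of virtual knots (respectively, long virtual knots) to an abelian group is a finite type invariant of GPV-order $\le m$ if for every diagram $D$ and any $m+1$ distinct real crossings $d_1,\dots,d_{m+1}$ of $D$, $$\sum_{\delta\in\{0,1\}^{m+1}} (-1)^{|\delta|}\, v(D_\delta)=0,$$ where $|\delta|$ is the number of $1$'s in $\delta$ and $D_\delta$ is obtained from $D$ by replacing each real crossing $d_i$ with $\delta_i=1$ by a virtual crossing. **Theorem 1.** Let $n\ge 0$ be an integer and let $K$ be a classical knot. There is an infinite sequence $(K_n^{\ell})_{\ell\ge 0}$ of classical knots, pairwise distinct (even as virtual knots), such that $v(K_n^{\ell})=v(K)$ for all $\ell$, all integers $0\le m\le n-1$, and every finite type invariant $v$ of virtual knots of GPV-order $\le m$ with values in any abelian group. The same holds for a classical long knot $K$, with classical long knots $K_n^{\ell}$ pairwise distinct as long virtual knots,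 and finite type invariants of long virtual knots. -/

import Mathlib

universe u

/-- One of the two endpoints of a signed arrow of a Gauss diagram: `chord` is the name of the arrow
(that is, of the real crossing), `isOver` says whether the endpoint lies on the over path (tail of the
arrow) or on the under path (head of the arrow), `sign` is the sign of the crossing. -/
@[ext]
structure Endpoint where
  chord : ℕ
  isOver : Bool
  sign : ℤˣ
deriving DecidableEq

/-- The other endpoint of the same arrow. -/
def Endpoint.opp (a : Endpoint) : Endpoint := ⟨a.chord, !a.isOver, a.sign⟩

/-- Change of the name of the arrow. -/
def Endpoint.relabel (f : Equiv.Perm ℕ) (a : Endpoint) : Endpoint := ⟨f a.chord, a.isOver, a.sign⟩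

/-- A Gauss diagram on an oriented line: the endpoints of its signed arrows in the order in which
they are met. Every arrow that occurs has exactly one tail and one head, with the same sign.
Read cyclically, the same word is a Gauss diagram on an oriented circle with a base point. -/
@[ext]
structure GaussDiagram where
  word : List Endpoint
  nodup : word.Nodup
  opp_mem : ∀ a ∈ word, a.opp ∈ word
  sign_eq : ∀ a ∈ word, ∀ b ∈ word, a.chord = b.chord → a.sign = b.sign

namespace GaussDiagram

/-- The arrows of a Gauss diagram, i.e. the real crossings of the virtual diagram. -/
def chords (D : GaussDiagram) : Finset ℕ := (D.word.map Endpoint.chord).toFinset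

/-- Virtualization: replacing the real crossings in `t` by virtual crossings deletes the
corresponding arrows from the Gauss diagram. -/
def virtualize (D : GaussDiagram) (t : Finset ℕ) : GaussDiagram where
  word := D.word.filter (fun a => a.chord ∉ t)
  nodup := D.nodup.filter _
  opp_mem a ha := by
    simp only [List.mem_filter, decide_eq_true_eq] at ha ⊢
    exact ⟨D.opp_mem a ha.1, ha.2⟩
  sign_eq a ha b hb h :=
    D.sign_eq a (List.mem_of_mem_filter ha) b (List.mem_of_mem_filter hb) h

/-- The two endpoints `a`, `b`, in this order if `σ = 1` and in the other order if `σ = -1`. -/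
def arrange (σ : ℤˣ) (a b : Endpoint) : List Endpoint := if σ = 1 then [a, b] else [b, a]

/-- Elementary moves between Gauss diagrams on a line: renaming of arrows and the Reidemeister moves.
The moves involving virtual crossings do not change the Gauss diagram. -/
inductive Move : GaussDiagram → GaussDiagram → Prop
  /-- The names of the arrows do not matter. -/
  | relabel {D E : GaussDiagram} (f : Equiv.Perm ℕ)
      (h : E.word = D.word.map (Endpoint.relabel f)) : Move D E
  /-- First Reidemeister move: creation of an isolated arrow, of any direction and sign. -/
  | r1 {D E : GaussDiagram} (u v : List Endpoint) (a : Endpoint)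
      (hD : D.word = u ++ v) (hE : E.word = u ++ [a, a.opp] ++ v) : Move D E
  /-- Second Reidemeister move: creation of two crossings of opposite signs between two arcs, one of
  which passes over the other at both. The arcs are parallel for `τ = 1`, antiparallel for
  `τ = -1`. -/
  | r2 {D E : GaussDiagram} (u v w : List Endpoint) (a b : Endpoint) (τ : ℤˣ)
      (hover : a.isOver = b.isOver) (hsign : a.sign = -b.sign)
      (hD : D.word = u ++ v ++ w)
      (hE : E.word = u ++ [a, b] ++ v ++ arrange τ a.opp b.opp ++ w) : Move D E
  /-- Third Reidemeister move: a top, a middle and a bottom strand cross pairwise, in crossings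
  `c` (top over middle), `d` (top over bottom) and `e` (middle over bottom) of signs `εc`, `εd`, `εe`.
  `σt = 1` if the top strand meets `c` before `d`, `σm = 1` if the middle strand meets `c` before
  `e`, and `σb = 1` if the bottom strand meets `d` before `e`. The hypotheses on the signs say that
  the three strands bound a triangle. The move reverses the order on each of the strands. -/
  | r3 {D E : GaussDiagram} (w₀ w₁ w₂ w₃ p q r : List Endpoint) (c d e : ℕ)
      (εc εd εe σt σm σb : ℤˣ)
      (h₁ : σm * εc = σb * εd) (h₂ : σm * εe = σt * εd)
      (hperm : [p, q, r].Perm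
        [arrange σt ⟨c, true, εc⟩ ⟨d, true, εd⟩,
         arrange σm ⟨c, false, εc⟩ ⟨e, true, εe⟩,
         arrange σb ⟨d, false, εd⟩ ⟨e, false, εe⟩])
      (hD : D.word = w₀ ++ p ++ w₁ ++ q ++ w₂ ++ r ++ w₃)
      (hE : E.word = w₀ ++ p.reverse ++ w₁ ++ q.reverse ++ w₂ ++ r.reverse ++ w₃) : Move D E

/-- Elementary moves between Gauss diagrams on a circle: in addition, the base point may be
moved. -/
def CircleMove (D E : GaussDiagram) : Prop := Move D E ∨ D.word.IsRotated E.word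

/-- `v`, a function of diagrams, is of GPV-order at most `n`: for any diagram and any `n + 1` of its
real crossings, the alternating sum over all ways to virtualize some of them vanishes. -/
def GPVOrderLE {G : Type u} [AddCommGroup G] (v : GaussDiagram → G) (n : ℕ) : Prop :=
  ∀ (D : GaussDiagram) (s : Finset ℕ), s ⊆ D.chords → s.card = n + 1 →
    ∑ t ∈ s.powerset, (-1 : ℤ) ^ t.card • v (D.virtualize t) = 0

/-- The four half-edges at each crossing of the closed diagram: `(a, true)` leaves the crossing
along the strand of the endpoint `a`, `(a, false)` enters it along that strand. -/
abbrev Dart (D : GaussDiagram) : Type := {x : Endpoint × Bool // x.1 ∈ D.word}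

/-- The other half of the edge of a half-edge: going out of an endpoint one comes in at the cyclically
next one. -/
def otherEnd (D : GaussDiagram) (x : Endpoint × Bool) : Endpoint × Bool :=
  if x.2 then (D.word.formPerm x.1, false) else (D.word.formPerm.symm x.1, true)

/-- The next half-edge counterclockwise around a crossing: at a positive crossing the cyclic order is
over out, under out, over in, under in, and at a negative crossing it is over out, under in,
over in, under out. -/
def turn (x : Endpoint × Bool) : Endpoint × Bool :=
  if (x.1.isOver = true ↔ x.1.sign = 1) then (x.1.opp, x.2) else (x.1.opp, !x.2)

/-- The faces: orbits of the half-edges under following an edge and then turning at its end.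
These are the discs that have to be glued to a ribbon neighbourhood of the curve to get a closed
surface. -/
def Face (D : GaussDiagram) : Type :=
  Quot (fun x y : D.Dart => (y : Endpoint × Bool) = turn (D.otherEnd x))

/-- The closed diagram can be drawn on the sphere (equivalently, in the plane) without virtual
crossings: the closed surface obtained from the curve has Euler characteristic `2`. The diagram
without crossings is a simple closed curve. -/
def IsPlanar (D : GaussDiagram) : Prop :=
  D.word = [] ∨ (D.chords.card : ℤ) - (D.word.length : ℤ) + (Nat.card D.Face : ℤ) = 2

end GaussDiagram

/-- Virtual knots: Gauss diagrams on a circle up to Reidemeister moves. -/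
def VirtualKnot : Type := Quot GaussDiagram.CircleMove

/-- Long virtual knots: Gauss diagrams on a line up to Reidemeister moves. -/
def LongVirtualKnot : Type := Quot GaussDiagram.Move

/-- The virtual knot of a Gauss diagram. -/
def VirtualKnot.mk (D : GaussDiagram) : VirtualKnot := Quot.mk _ D

/-- The long virtual knot of a Gauss diagram. -/
def LongVirtualKnot.mk (D : GaussDiagram) : LongVirtualKnot := Quot.mk _ D

/-- A classical knot: a virtual knot that has a diagram without virtual crossings. -/
def VirtualKnot.IsClassical (K : VirtualKnot) : Prop :=
  ∃ D : GaussDiagram, D.IsPlanar ∧ K = VirtualKnot.mk D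

/-- A classical long knot: a long virtual knot that has a diagram without virtual crossings. -/
def LongVirtualKnot.IsClassical (K : LongVirtualKnot) : Prop :=
  ∃ D : GaussDiagram, D.IsPlanar ∧ K = LongVirtualKnot.mk D

/-- `v` is a finite type invariant of virtual knots of GPV-order at most `n`. -/
def VirtualKnot.GPVOrderLE {G : Type u} [AddCommGroup G] (v : VirtualKnot → G) (n : ℕ) : Prop :=
  GaussDiagram.GPVOrderLE (fun D => v (VirtualKnot.mk D)) n

/-- `v` is a finite type invariant of long virtual knots of GPV-order at most `n`. -/
def LongVirtualKnot.GPVOrderLE {G : Type u} [AddCommGroup G] (v : LongVirtualKnot → G) (n : ℕ) :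
    Prop :=
  GaussDiagram.GPVOrderLE (fun D => v (LongVirtualKnot.mk D)) n

/-! The sequence is built from connected sums with knots that come from iterated commutators of pure
braids on three strands. A long knot runs up the first strand, down the second and up the third. The
braids are products of clasps (full twists of two neighbouring strands), and each clasp carries a
label in `ℕ`: label `0` means a clasp of strands two and three, any other label a clasp of strands
one and two. A word in the free group on `ℕ` thus gives a tangle, and cancelling a letter against
its inverse is a pair of second Reidemeister moves. The labels are finer than the braids, and this
is what is exploited: the word of the iterated commutator of the generators `0, …, n` becomes
trivial as soon as all letters with one of these labels are deleted, although as a braid it involves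
only two clasps and their inverses.

Deleting letters is virtualizing crossings. So the crossings split into disjoint label sets, and
virtualizing any nonempty union of the sets with labels at most `n` gives back the original knot
(`virtualize_insertTangle`, `mk_insertTangle`). An alternating sum over such sets is a sum of
alternating sums over single crossings, hence an invariant of order `m ≤ n` cannot see the insertion
(`GPVOrderLE.eq_of_sets`, `eq_of_iteratedCommutator`).

The knots stay classical because a clasp adds two crossings and two faces, which preserves the Euler
characteristic (`faces_insertTangle`). They are told apart by Fox colorings. Braids act on colors
through the reduced Burau representation at `-1`, and the corner entry `p` of the matrix of the
commutator is at least `3` (`burau_iteratedCommutator`). Modulo `p` the tangle has a nontrivial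
coloring that is zero at both ends, so every further summand at least doubles a lower bound for the
number of colorings (`ncard_basedColorings_insertTangle`). The number is unbounded, hence infinitely
many of the sums are distinct, and a subsequence is injective. The colorings live on the closed
knot, so the same diagrams serve for knots and long knots. -/

namespace Endpoint

/-! ### Endpoints, Gauss words and virtualization. -/

@[simp] theorem opp_opp (a : Endpoint) : a.opp.opp = a := by
  simp [Endpoint.opp]

@[simp] theorem opp_chord (a : Endpoint) : a.opp.chord = a.chord := rfl

@[simp] theorem opp_isOver (a : Endpoint) : a.opp.isOver = !a.isOver := rfl

@[simp] theorem opp_sign (a : Endpoint) : a.opp.sign = a.sign := rfl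

theorem opp_ne (a : Endpoint) : a.opp ≠ a := by
  intro h
  have := congrArg Endpoint.isOver h
  simp at this

theorem eq_or_eq_opp {a e : Endpoint} (hc : e.chord = a.chord) (hs : e.sign = a.sign) :
    e = a ∨ e = a.opp := by
  obtain ⟨c, o, s⟩ := a
  obtain ⟨c', o', s'⟩ := e
  cases o <;> cases o' <;> simp_all [Endpoint.opp]

end Endpoint

namespace GaussDiagram

theorem eq_or_eq_opp (D : GaussDiagram) {a e : Endpoint} (ha : a ∈ D.word) (he : e ∈ D.word)
    (h : e.chord = a.chord) : e = a ∨ e = a.opp :=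
  Endpoint.eq_or_eq_opp h (D.sign_eq e he a ha h)

/-- The condition on a word to be a Gauss diagram. -/
structure IsGauss (w : List Endpoint) : Prop where
  nodup : w.Nodup
  opp_mem : ∀ a ∈ w, a.opp ∈ w
  sign_eq : ∀ a ∈ w, ∀ b ∈ w, a.chord = b.chord → a.sign = b.sign

/-- The Gauss diagram of a word. -/
def ofWord (w : List Endpoint) (h : IsGauss w) : GaussDiagram := ⟨w, h.nodup, h.opp_mem, h.sign_eq⟩

theorem isGauss_word (D : GaussDiagram) : IsGauss D.word := ⟨D.nodup, D.opp_mem, D.sign_eq⟩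

theorem IsGauss.perm {w w' : List Endpoint} (h : IsGauss w) (hp : w.Perm w') : IsGauss w' :=
  ⟨hp.nodup_iff.1 h.nodup, fun a ha => hp.mem_iff.1 (h.opp_mem a (hp.mem_iff.2 ha)),
    fun a ha b hb => h.sign_eq a (hp.mem_iff.2 ha) b (hp.mem_iff.2 hb)⟩

theorem IsGauss.append {w w' : List Endpoint} (h : IsGauss w) (h' : IsGauss w')
    (hd : ∀ a ∈ w, ∀ b ∈ w', a.chord ≠ b.chord) : IsGauss (w ++ w') := by
  refine ⟨List.nodup_append.2 ⟨h.nodup, h'.nodup, fun a ha b hb e => hd a ha b hb (e ▸ rfl)⟩, ?_, ?_⟩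
  · intro a ha
    rcases List.mem_append.1 ha with ha | ha
    · exact List.mem_append_left _ (h.opp_mem a ha)
    · exact List.mem_append_right _ (h'.opp_mem a ha)
  · intro a ha b hb hab
    rcases List.mem_append.1 ha with ha | ha <;> rcases List.mem_append.1 hb with hb | hb
    · exact h.sign_eq a ha b hb hab
    · exact (hd a ha b hb hab).elim
    · exact (hd b hb a ha hab.symm).elim
    · exact h'.sign_eq a ha b hb hab

theorem mem_chords {D : GaussDiagram} {c : ℕ} : c ∈ D.chords ↔ ∃ a ∈ D.word, a.chord = c := by
  simp [chords]

/-- An arrow has only two endpoints. The Reidemeister moves do not say that the arrows they create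
are new; this recovers it from the larger diagram. -/
theorem chord_ne_of_perm (E : GaussDiagram) {a : Endpoint} {w : List Endpoint}
    (h : E.word.Perm (a :: a.opp :: w)) : ∀ e ∈ w, e.chord ≠ a.chord := by
  intro e he hc
  have hn := h.nodup_iff.1 E.nodup
  have he' : e ∈ E.word := h.mem_iff.2 (by simp [he])
  have ha' : a ∈ E.word := h.mem_iff.2 (by simp)
  simp only [List.nodup_cons, List.mem_cons, not_or] at hn
  rcases E.eq_or_eq_opp ha' he' hc with rfl | rfl
  · exact hn.1.2 he
  · exact hn.2.1 he

theorem length_word (D : GaussDiagram) : D.word.length = 2 * D.chords.card := by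
  classical
  have h1 : D.word.length = D.word.toFinset.card := (List.toFinset_card_of_nodup D.nodup).symm
  have h2 : ∀ a ∈ D.word.toFinset, a.chord ∈ D.chords := by
    intro a ha
    exact mem_chords.2 ⟨a, by simpa using ha, rfl⟩
  rw [h1, Finset.card_eq_sum_card_fiberwise h2, Finset.sum_const_nat (m := 2), mul_comm]
  intro c hc
  obtain ⟨a, ha, rfl⟩ := mem_chords.1 hc
  have : D.word.toFinset.filter (fun e => e.chord = a.chord) = {a, a.opp} := by
    ext e
    simp only [Finset.mem_filter, List.mem_toFinset, Finset.mem_insert, Finset.mem_singleton]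
    constructor
    · rintro ⟨he, hc⟩
      exact D.eq_or_eq_opp ha he hc
    · rintro (rfl | rfl)
      · exact ⟨ha, rfl⟩
      · exact ⟨D.opp_mem a ha, rfl⟩
  rw [this, Finset.card_pair (Endpoint.opp_ne a).symm]

/-- There are two endpoints to an arrow and as many edges as endpoints. In this form planarity
survives whenever four endpoints come with two faces. -/
theorem isPlanar_iff (D : GaussDiagram) (h : D.word ≠ []) :
    D.IsPlanar ↔ 2 * Nat.card D.Face = D.word.length + 4 := by
  have := D.length_word
  simp only [IsPlanar, h, false_or]
  omega

theorem virtualize_virtualize (D : GaussDiagram) (s t : Finset ℕ) :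
    (D.virtualize s).virtualize t = D.virtualize (s ∪ t) := by
  ext1
  simp only [virtualize, List.filter_filter, Finset.mem_union, not_or]
  congr 1
  ext a
  simp [Bool.and_comm]

theorem virtualize_empty (D : GaussDiagram) : D.virtualize ∅ = D := by
  ext1
  simp [virtualize]

theorem chords_virtualize (D : GaussDiagram) (t : Finset ℕ) :
    (D.virtualize t).chords = D.chords \ t := by
  ext c
  simp only [mem_chords, virtualize, List.mem_filter, decide_eq_true_eq, Finset.mem_sdiff]
  constructor
  · rintro ⟨a, ⟨ha, h⟩, rfl⟩
    exact ⟨⟨a, ha, rfl⟩, h⟩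
  · rintro ⟨⟨a, ha, rfl⟩, h⟩
    exact ⟨a, ⟨ha, h⟩, rfl⟩

end GaussDiagram

/-- The virtual knot obtained by closing a long virtual knot. -/
def LongVirtualKnot.close : LongVirtualKnot → VirtualKnot :=
  Quot.map id fun _ _ h => Or.inl h

namespace GaussDiagram

/-! ### Fox colorings of Gauss diagrams and their invariance. -/

section Coloring

variable {R : Type*} [CommRing R]

/-- The rule for Fox colorings: passing the endpoint `e`, the color changes from `x` to `y`; `h` gives
the color of the over path at each crossing. -/
def Pass (h : ℕ → R) (e : Endpoint) (x y : R) : Prop :=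
  if e.isOver = true then x = y ∧ h e.chord = x else x + y = 2 * h e.chord

/-- Passing a sequence of endpoints, the color changes from `x` to `y`. -/
def Run (h : ℕ → R) : R → List Endpoint → R → Prop
  | x, [], y => x = y
  | x, e :: w, y => ∃ z, Pass h e x z ∧ Run h z w y

theorem pass_comm {h : ℕ → R} {e : Endpoint} {x y : R} : Pass h e x y ↔ Pass h e y x := by
  unfold Pass
  split_ifs
  · constructor <;> rintro ⟨rfl, h⟩ <;> exact ⟨rfl, h⟩
  · rw [add_comm]

theorem Pass.unique {h : ℕ → R} {e : Endpoint} {x y z : R} (hy : Pass h e x y) (hz : Pass h e x z) :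
    y = z := by
  unfold Pass at hy hz
  split_ifs at hy hz
  · exact hy.1.symm.trans hz.1
  · exact add_left_cancel (hy.trans hz.symm)

theorem run_append {h : ℕ → R} {u v : List Endpoint} {x y : R} :
    Run h x (u ++ v) y ↔ ∃ z, Run h x u z ∧ Run h z v y := by
  induction u generalizing x with
  | nil => simp [Run]
  | cons e u ih =>
    simp only [List.cons_append, Run, ih]
    constructor
    · rintro ⟨z, hz, t, h1, h2⟩
      exact ⟨t, ⟨z, hz, h1⟩, h2⟩
    · rintro ⟨t, ⟨z, hz, h1⟩, h2⟩
      exact ⟨z, hz, t, h1, h2⟩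

theorem run_singleton {h : ℕ → R} {e : Endpoint} {x y : R} : Run h x [e] y ↔ Pass h e x y := by
  simp [Run]

/-- The coloring rule is symmetric in the colors before and after an endpoint, so a strand may be
read in either direction. The third Reidemeister move and the backward second strand of `tangle`
need this. -/
theorem run_reverse {h : ℕ → R} {w : List Endpoint} {x y : R} :
    Run h x w.reverse y ↔ Run h y w x := by
  induction w generalizing x y with
  | nil => simp [Run, eq_comm]
  | cons e w ih =>
    rw [List.reverse_cons, run_append]
    simp only [run_singleton, ih]
    simp only [Run]
    exact exists_congr fun z => by rw [and_comm, pass_comm]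

theorem run_congr {h h' : ℕ → R} {w : List Endpoint} (hw : ∀ e ∈ w, h e.chord = h' e.chord) {x y : R} :
    Run h x w y ↔ Run h' x w y := by
  induction w generalizing x with
  | nil => simp [Run]
  | cons e w ih =>
    have h1 := hw e (by simp)
    have h2 : ∀ z, Run h z w y ↔ Run h' z w y := fun z => ih fun e he => hw e (by simp [he])
    simp only [Run, h2, Pass, h1]

theorem Run.unique {h : ℕ → R} {w : List Endpoint} {x y z : R} (hy : Run h x w y) (hz : Run h x w z) :
    y = z := by
  induction w generalizing x with
  | nil => exact hy.symm.trans hz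
  | cons e w ih =>
    obtain ⟨s, hs, hy⟩ := hy
    obtain ⟨t, ht, hz⟩ := hz
    obtain rfl := hs.unique ht
    exact ih hy hz

theorem run_const (w : List Endpoint) (x : R) : Run (fun _ => x) x w x := by
  induction w with
  | nil => rfl
  | cons e w ih =>
    refine ⟨x, ?_, ih⟩
    unfold Pass
    split_ifs
    · exact ⟨rfl, rfl⟩
    · ring

/-- The Fox colorings of the closed diagram with the given word: the color at the base point and the
colors of the over paths at the crossings. -/
def colorings (R : Type*) [CommRing R] (w : List Endpoint) : Set (R × (ℕ → R)) :=
  {q | (∀ c, c ∉ w.map Endpoint.chord → q.2 c = 0) ∧ Run q.2 q.1 w q.1}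

theorem finite_colorings [Finite R] (w : List Endpoint) : (colorings R w).Finite := by
  have hinj : Function.Injective (fun (q : colorings R w) =>
      (q.1.1, fun c : {c // c ∈ w.map Endpoint.chord} => q.1.2 c.1)) := by
    rintro ⟨⟨x, h⟩, hq⟩ ⟨⟨x', h'⟩, hq'⟩ he
    simp only [Prod.mk.injEq] at he
    obtain ⟨rfl, he⟩ := he
    have : h = h' := by
      funext c
      by_cases hc : c ∈ w.map Endpoint.chord
      · exact congrFun he ⟨c, hc⟩
      · exact (hq.1 c hc).trans (hq'.1 c hc).symm
    subst this
    rfl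
  have : Finite {c // c ∈ w.map Endpoint.chord} := List.finite_toSet _
  exact Set.finite_coe_iff.1 (Finite.of_injective _ hinj)

/-- `T` consists of the arrows that a move creates. Forgetting their colors, that is, setting them
to zero, is a bijection: extensions exist by `h₂` and are unique by `h₃`. -/
theorem ncard_colorings_of_extension {w w' : List Endpoint} {T : Set ℕ}
    (hT : ∀ c, c ∈ w'.map Endpoint.chord ↔ c ∈ w.map Endpoint.chord ∨ c ∈ T)
    (hw : ∀ c ∈ w.map Endpoint.chord, c ∉ T)
    (h₁ : ∀ (h : ℕ → R) x, Run h x w' x → Run h x w x)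
    (h₂ : ∀ (h : ℕ → R) x, Run h x w x → ∃ h' : ℕ → R, (∀ c ∉ T, h' c = h c) ∧ Run h' x w' x)
    (h₃ : ∀ (h h' : ℕ → R) x, Run h x w' x → Run h' x w' x → (∀ c ∉ T, h' c = h c) →
      ∀ c ∈ T, h' c = h c) :
    (colorings R w').ncard = (colorings R w).ncard := by
  classical
  have key : ∀ (h : ℕ → R), ∀ e ∈ w, (fun c => if c ∈ T then 0 else h c) e.chord = h e.chord := by
    intro h e he
    simp [hw e.chord (List.mem_map_of_mem he)]
  refine Set.ncard_congr (fun q _ => (q.1, fun c => if c ∈ T then 0 else q.2 c)) ?_ ?_ ?_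
  · rintro ⟨x, h⟩ ⟨hs, hr⟩
    refine ⟨?_, ?_⟩
    · intro c hc
      by_cases hcT : c ∈ T
      · simp [hcT]
      · simp only [hcT, if_false]
        exact hs c fun hc' => ((hT c).1 hc').elim hc hcT
    · exact (run_congr (key h)).2 (h₁ h x hr)
  · rintro ⟨x, h⟩ ⟨x', h'⟩ ⟨hs, hr⟩ ⟨hs', hr'⟩ he
    simp only [Prod.mk.injEq] at he
    obtain ⟨rfl, he⟩ := he
    have h0 : ∀ c ∉ T, h' c = h c := by
      intro c hc
      have := congrFun he c
      simpa [hc, eq_comm] using this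
    have : h = h' := by
      funext c
      by_cases hc : c ∈ T
      · exact (h₃ h h' x hr hr' h0 c hc).symm
      · exact (h0 c hc).symm
    subst this
    rfl
  · rintro ⟨x, h⟩ ⟨hs, hr⟩
    obtain ⟨h', h0, hr'⟩ := h₂ h x hr
    refine ⟨(x, h'), ⟨?_, hr'⟩, ?_⟩
    · intro c hc
      rw [hT, not_or] at hc
      exact (h0 c hc.2).trans (hs c hc.1)
    · simp only [Prod.mk.injEq, true_and]
      funext c
      by_cases hc : c ∈ T
      · simp only [hc, if_true]
        exact (hs c fun hc' => hw c hc' hc).symm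
      · simp [hc, h0 c hc]

/-- In a kink the strand is reflected in its own color, which fixes it. No division by two is
involved, so any commutative ring is allowed. -/
theorem run_pair_opp {h : ℕ → R} {a : Endpoint} {x y : R} :
    Run h x [a, a.opp] y ↔ x = y ∧ h a.chord = x := by
  obtain ⟨c, o, s⟩ := a
  cases o <;> simp only [Run, Pass, Endpoint.opp, Bool.false_eq_true, if_false, if_true,
    Bool.not_true, Bool.not_false]
  · constructor
    · rintro ⟨z, h1, _, ⟨rfl, h2⟩, rfl⟩
      exact ⟨by linear_combination h1 + 2 * h2, by linear_combination -h1 - h2⟩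
    · rintro ⟨rfl, rfl⟩
      exact ⟨_, by ring, _, ⟨rfl, rfl⟩, rfl⟩
  · constructor
    · rintro ⟨_, ⟨rfl, h1⟩, z, h2, rfl⟩
      exact ⟨by linear_combination -h2 - 2 * h1, h1⟩
    · rintro ⟨rfl, rfl⟩
      exact ⟨_, ⟨rfl, rfl⟩, _, by ring, rfl⟩

theorem run_pair_over {h : ℕ → R} {a b : Endpoint} (ha : a.isOver = true) (hb : b.isOver = true)
    {x y : R} : Run h x [a, b] y ↔ x = y ∧ h a.chord = x ∧ h b.chord = x := by
  simp only [Run, Pass, ha, hb, if_true]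
  constructor
  · rintro ⟨z, ⟨rfl, h1⟩, z', ⟨rfl, h2⟩, rfl⟩
    exact ⟨rfl, h1, h2⟩
  · rintro ⟨rfl, h1, h2⟩
    exact ⟨x, ⟨rfl, h1⟩, x, ⟨rfl, h2⟩, rfl⟩

/-- Two reflections compose to a translation, which is trivial when both over paths have the same
color, as in a second Reidemeister move. -/
theorem run_pair_under {h : ℕ → R} {a b : Endpoint} (ha : a.isOver = false) (hb : b.isOver = false)
    {x y : R} : Run h x [a, b] y ↔ y = x + 2 * h b.chord - 2 * h a.chord := by
  simp only [Run, Pass, ha, hb]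
  constructor
  · rintro ⟨z, h1, z', h2, rfl⟩
    simp only [Bool.false_eq_true, if_false] at h1 h2
    linear_combination h2 - h1
  · rintro rfl
    refine ⟨2 * h a.chord - x, ?_, _, ?_, rfl⟩ <;> simp only [Bool.false_eq_true, if_false] <;> ring

theorem run_arrange {h : ℕ → R} {a b : Endpoint} (σ : ℤˣ) {x y : R}
    (P : Prop) (h1 : Run h x [a, b] y ↔ P) (h2 : Run h x [b, a] y ↔ P) :
    Run h x (arrange σ a b) y ↔ P := by
  unfold arrange
  split_ifs
  · exact h1
  · exact h2

theorem run_arrange_over {h : ℕ → R} {a b : Endpoint} (σ : ℤˣ) (ha : a.isOver = true)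
    (hb : b.isOver = true) {x y : R} :
    Run h x (arrange σ a b) y ↔ x = y ∧ h a.chord = x ∧ h b.chord = x := by
  apply run_arrange
  · exact run_pair_over ha hb
  · rw [run_pair_over hb ha, and_comm (a := h b.chord = x)]

theorem run_arrange_under {h : ℕ → R} {a b : Endpoint} (σ : ℤˣ) (ha : a.isOver = false)
    (hb : b.isOver = false) (hab : h a.chord = h b.chord) {x y : R} :
    Run h x (arrange σ a b) y ↔ x = y := by
  apply run_arrange
  · rw [run_pair_under ha hb, hab, add_sub_cancel_right, eq_comm]
  · rw [run_pair_under hb ha, hab, add_sub_cancel_right, eq_comm]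

theorem arrange_perm (σ : ℤˣ) (a b : Endpoint) : (arrange σ a b).Perm [a, b] := by
  unfold arrange
  split_ifs
  · exact List.Perm.refl _
  · exact List.Perm.swap _ _ _

theorem arrange_reverse (σ : ℤˣ) (a b : Endpoint) : (arrange σ a b).reverse = arrange (-σ) a b := by
  rcases Int.units_eq_one_or σ with rfl | rfl <;> simp [arrange]

theorem ncard_colorings_rotate_one (w : List Endpoint) :
    (colorings R (w.rotate 1)).ncard = (colorings R w).ncard := by
  cases w with
  | nil => rfl
  | cons e w =>
    rw [List.rotate_cons_succ, List.rotate_zero]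
    symm
    have hr : ∀ (h : ℕ → R) x, Run h x (e :: w) x ↔ ∃ z, Pass h e x z ∧ Run h z (w ++ [e]) z := by
      intro h x
      simp only [Run, run_append, exists_eq_right]
      constructor
      · rintro ⟨z, hz, hw⟩
        exact ⟨z, hz, x, hw, hz⟩
      · rintro ⟨z, hz, t, hw, ht⟩
        obtain rfl := (pass_comm.1 ht).unique (pass_comm.1 hz)
        exact ⟨z, hz, hw⟩
    have hm : ∀ c, c ∈ (w ++ [e]).map Endpoint.chord ↔ c ∈ (e :: w).map Endpoint.chord := by
      intro c
      simp [or_comm]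
    -- Moving the base point past `e` keeps the crossing colors and replaces the base color by the
    -- one after `e`; off the colorings the value `0` is junk.
    have hch : ∀ q : R × (ℕ → R), ∃ z, q ∈ colorings R (e :: w) →
        Pass q.2 e q.1 z ∧ Run q.2 z (w ++ [e]) z := by
      intro q
      by_cases hq : q ∈ colorings R (e :: w)
      · obtain ⟨z, hz⟩ := (hr q.2 q.1).1 hq.2
        exact ⟨z, fun _ => hz⟩
      · exact ⟨0, fun h => (hq h).elim⟩
    choose f hf using hch
    refine Set.ncard_congr (fun q _ => (f q, q.2)) ?_ ?_ ?_
    · rintro q hq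
      refine ⟨fun c hc => hq.1 c ?_, (hf q hq).2⟩
      rw [← hm]
      simpa using hc
    · rintro q q' hq hq' he
      simp only [Prod.mk.injEq] at he
      have h1 := (hf q hq).1
      have h2 := (hf q' hq').1
      rw [← he.1, ← he.2, pass_comm] at h2
      exact Prod.ext ((pass_comm.1 h1).unique h2) he.2
    · rintro ⟨z, h⟩ ⟨hs, hz⟩
      have hz' : Run h z (w ++ [e]) z := by simpa using hz
      obtain ⟨x, hx, hx'⟩ := run_append.1 hz'
      have hp : Pass h e x z := by simpa [Run] using hx'
      have hmem : (x, h) ∈ colorings R (e :: w) := by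
        refine ⟨fun c hc => hs c ?_, (hr h x).2 ⟨z, hp, hz'⟩⟩
        rw [← hm] at hc
        simpa using hc
      refine ⟨(x, h), hmem, ?_⟩
      rw [(hf _ hmem).1.unique hp]

theorem ncard_colorings_of_isRotated {w w' : List Endpoint} (h : w.IsRotated w') :
    (colorings R w).ncard = (colorings R w').ncard := by
  obtain ⟨n, rfl⟩ := h
  induction n with
  | zero => simp
  | succ n ih => rw [ih, ← List.rotate_rotate, ncard_colorings_rotate_one]

theorem ncard_colorings_of_relabel {D E : GaussDiagram} (f : Equiv.Perm ℕ)
    (h : E.word = D.word.map (Endpoint.relabel f)) :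
    (colorings R E.word).ncard = (colorings R D.word).ncard := by
  have hrun : ∀ (w : List Endpoint) (k : ℕ → R) x y,
      Run k x (w.map (Endpoint.relabel f)) y ↔ Run (k ∘ f) x w y := by
    intro w k x y
    induction w generalizing x with
    | nil => simp [Run]
    | cons e w ih => simp [Run, Pass, Endpoint.relabel, ih]
  have hm : ∀ c, f c ∈ E.word.map Endpoint.chord ↔ c ∈ D.word.map Endpoint.chord := by
    intro c
    simp [h, Endpoint.relabel]
  refine Set.ncard_congr (fun q _ => (q.1, q.2 ∘ f)) ?_ ?_ ?_
  · rintro ⟨x, k⟩ ⟨hs, hr⟩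
    refine ⟨fun c hc => hs _ fun hc' => hc ((hm c).1 hc'), ?_⟩
    rw [h, hrun] at hr
    exact hr
  · rintro ⟨x, k⟩ ⟨x', k'⟩ _ _ he
    simp only [Prod.mk.injEq] at he
    refine Prod.ext he.1 (f.surjective.injective_comp_right he.2)
  · rintro ⟨x, k⟩ ⟨hs, hr⟩
    have hk : (k ∘ f.symm) ∘ f = k := by
      funext c
      simp
    refine ⟨(x, k ∘ f.symm), ⟨fun c hc => hs _ fun hc' => hc ?_, ?_⟩, by simp [hk]⟩
    · rw [← hm] at hc'
      simpa using hc'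
    · rw [h, hrun, hk]
      exact hr

theorem ncard_colorings_of_r1 {D E : GaussDiagram} {u v : List Endpoint} {a : Endpoint}
    (hD : D.word = u ++ v) (hE : E.word = u ++ [a, a.opp] ++ v) :
    (colorings R E.word).ncard = (colorings R D.word).ncard := by
  have hne : ∀ e ∈ u ++ v, e.chord ≠ a.chord := by
    apply E.chord_ne_of_perm
    rw [hE, List.append_assoc]
    exact (List.perm_append_comm_assoc u [a, a.opp] v)
  rw [hD, hE]
  have hiff : ∀ (h : ℕ → R) x, Run h x (u ++ [a, a.opp] ++ v) x ↔
      ∃ z, Run h x u z ∧ h a.chord = z ∧ Run h z v x := by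
    intro h x
    simp only [run_append, run_pair_opp]
    constructor
    · rintro ⟨_, ⟨z, h1, rfl, h2⟩, h3⟩
      exact ⟨z, h1, h2, h3⟩
    · rintro ⟨z, h1, h2, h3⟩
      exact ⟨z, ⟨z, h1, rfl, h2⟩, h3⟩
  apply ncard_colorings_of_extension (T := {a.chord})
  · intro c
    simp only [List.map_append, List.map_cons, List.map_nil, List.mem_append, List.mem_cons,
      Endpoint.opp_chord, List.not_mem_nil, Set.mem_singleton_iff]
    tauto
  · intro c hc
    obtain ⟨e, he, rfl⟩ := List.mem_map.1 hc
    exact hne e he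
  · intro h x hr
    obtain ⟨z, h1, -, h3⟩ := (hiff h x).1 hr
    exact run_append.2 ⟨z, h1, h3⟩
  · intro h x hr
    obtain ⟨z, h1, h3⟩ := run_append.1 hr
    refine ⟨Function.update h a.chord z, ?_, (hiff _ x).2 ⟨z, ?_, by simp, ?_⟩⟩
    · intro c hc
      exact Function.update_of_ne hc _ _
    · refine (run_congr fun e he => ?_).2 h1
      exact Function.update_of_ne (hne e (by simp [he])) _ _
    · refine (run_congr fun e he => ?_).2 h3
      exact Function.update_of_ne (hne e (by simp [he])) _ _
  · intro h h' x hr hr' heq c hc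
    obtain ⟨z, h1, h2, -⟩ := (hiff _ _).1 hr
    obtain ⟨z', h1', h2', -⟩ := (hiff _ _).1 hr'
    have := (run_congr fun e he => heq e.chord (hne e (by simp [he]))).1 h1'
    rw [Set.mem_singleton_iff.1 hc, h2, h2']
    exact this.unique h1

theorem r2_perm {u v w : List Endpoint} {a b : Endpoint} {τ : ℤˣ} :
    (u ++ [a, b] ++ v ++ arrange τ a.opp b.opp ++ w).Perm (a :: a.opp :: b :: b.opp :: (u ++ v ++ w)) := by
  have h1 : (u ++ [a, b] ++ v ++ arrange τ a.opp b.opp ++ w).Perm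
      (u ++ [a, b] ++ v ++ [a.opp, b.opp] ++ w) :=
    List.Perm.append_right _ (List.Perm.append_left _ (arrange_perm _ _ _))
  refine h1.trans ?_
  rw [List.perm_iff_count]
  intro x
  simp only [List.count_append, List.count_cons, List.count_nil]
  omega

theorem ncard_colorings_of_r2 {D E : GaussDiagram} {u v w : List Endpoint} {a b : Endpoint} {τ : ℤˣ}
    (hover : a.isOver = b.isOver)
    (hD : D.word = u ++ v ++ w)
    (hE : E.word = u ++ [a, b] ++ v ++ arrange τ a.opp b.opp ++ w) :
    (colorings R E.word).ncard = (colorings R D.word).ncard := by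
  have hp : E.word.Perm (a :: a.opp :: b :: b.opp :: (u ++ v ++ w)) := hE ▸ r2_perm
  have hp' : E.word.Perm (b :: b.opp :: a :: a.opp :: (u ++ v ++ w)) := by
    refine hp.trans ?_
    rw [List.perm_iff_count]
    intro x
    simp only [List.count_cons]
    omega
  have hne : ∀ e ∈ u ++ v ++ w, e.chord ≠ a.chord ∧ e.chord ≠ b.chord := fun e he =>
    ⟨E.chord_ne_of_perm hp e (List.mem_cons_of_mem _ (List.mem_cons_of_mem _ he)),
      E.chord_ne_of_perm hp' e (List.mem_cons_of_mem _ (List.mem_cons_of_mem _ he))⟩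
  rw [hD, hE]
  -- Both new crossings take the color of the over arc, which is `z` if this is the first arc and
  -- `t` if it is the second; the two underpasses then cancel.
  have hiff : ∀ (h : ℕ → R) x, Run h x (u ++ [a, b] ++ v ++ arrange τ a.opp b.opp ++ w) x ↔
      ∃ z t, Run h x u z ∧ Run h z v t ∧ Run h t w x ∧
        h a.chord = (if a.isOver = true then z else t) ∧ h b.chord = h a.chord := by
    intro h x
    by_cases ho : a.isOver = true
    · have ho' : b.isOver = true := hover ▸ ho
      have h1 := fun x y => run_pair_over (h := h) ho ho' (x := x) (y := y)
      simp only [run_append, ho, if_true, h1]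
      constructor
      · rintro ⟨s, ⟨t, ⟨_, ⟨z, hz, rfl, ha, hb⟩, ht⟩, hs⟩, hx⟩
        have := (run_arrange_under τ (a := a.opp) (b := b.opp) (by simp [ho]) (by simp [ho'])
          (by simp [ha, hb])).1 hs
        subst this
        exact ⟨z, t, hz, ht, hx, ha, hb.trans ha.symm⟩
      · rintro ⟨z, t, hz, ht, hx, ha, hb⟩
        refine ⟨t, ⟨t, ⟨z, ⟨z, hz, rfl, ha, hb.trans ha⟩, ht⟩, ?_⟩, hx⟩
        exact (run_arrange_under τ (a := a.opp) (b := b.opp) (by simp [ho]) (by simp [ho'])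
          (by simp [hb])).2 rfl
    · have ho : a.isOver = false := by simpa using ho
      have ho' : b.isOver = false := hover ▸ ho
      have h1 := fun x y => run_arrange_over (h := h) τ (a := a.opp) (b := b.opp) (by simp [ho])
        (by simp [ho']) (x := x) (y := y)
      simp only [run_append, ho, h1, Endpoint.opp_chord, Bool.false_eq_true, if_false]
      constructor
      · rintro ⟨_, ⟨t, ⟨s, ⟨z, hz, hs⟩, ht⟩, rfl, ha, hb⟩, hx⟩
        rw [run_pair_under ho ho', ha, hb, add_sub_cancel_right] at hs
        subst hs
        exact ⟨s, t, hz, ht, hx, ha, hb.trans ha.symm⟩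
      · rintro ⟨z, t, hz, ht, hx, ha, hb⟩
        refine ⟨t, ⟨t, ⟨z, ⟨z, hz, ?_⟩, ht⟩, rfl, ha, hb.trans ha⟩, hx⟩
        rw [run_pair_under ho ho', hb, add_sub_cancel_right]
  apply ncard_colorings_of_extension (T := {a.chord, b.chord})
  · intro c
    have : c ∈ (arrange τ a.opp b.opp).map Endpoint.chord ↔ c = a.chord ∨ c = b.chord := by
      rw [((arrange_perm τ a.opp b.opp).map _).mem_iff]
      simp
    simp only [List.map_append, List.mem_append, this, List.map_cons, List.map_nil, List.mem_cons,
      List.not_mem_nil, Set.mem_insert_iff, Set.mem_singleton_iff]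
    tauto
  · intro c hc
    obtain ⟨e, he, rfl⟩ := List.mem_map.1 hc
    simpa using hne e he
  · intro h x hr
    obtain ⟨z, t, h1, h2, h3, -⟩ := (hiff h x).1 hr
    exact run_append.2 ⟨t, run_append.2 ⟨z, h1, h2⟩, h3⟩
  · intro h x hr
    obtain ⟨t, hr, h3⟩ := run_append.1 hr
    obtain ⟨z, h1, h2⟩ := run_append.1 hr
    set s := if a.isOver = true then z else t with hs
    set h' : ℕ → R := fun c => if c = a.chord ∨ c = b.chord then s else h c with hh'
    have key : ∀ e ∈ u ++ v ++ w, h' e.chord = h e.chord := by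
      intro e he
      simp [hh', hne e he]
    refine ⟨h', ?_, (hiff _ x).2 ⟨z, t, ?_, ?_, ?_, ?_, ?_⟩⟩
    · intro c hc
      simp only [Set.mem_insert_iff, Set.mem_singleton_iff] at hc
      simp [hh', hc]
    · exact (run_congr fun e he => key e (by simp [he])).2 h1
    · exact (run_congr fun e he => key e (by simp [he])).2 h2
    · exact (run_congr fun e he => key e (by simp [he])).2 h3
    · simp [hh', hs]
    · simp [hh']
  · intro h h' x hr hr' heq
    obtain ⟨z, t, h1, h2, -, h3, h4⟩ := (hiff _ _).1 hr
    obtain ⟨z', t', h1', h2', -, h3', h4'⟩ := (hiff _ _).1 hr'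
    have key : ∀ e ∈ u ++ v ++ w, h' e.chord = h e.chord := by
      intro e he
      exact heq e.chord (by simpa using hne e he)
    obtain rfl := ((run_congr fun e he => key e (by simp [he])).1 h1').unique h1
    obtain rfl := ((run_congr fun e he => key e (by simp [he])).1 h2').unique h2
    have hab : h' a.chord = h a.chord := h3'.trans h3.symm
    intro c hc
    rcases hc with rfl | hc
    · exact hab
    · rw [Set.mem_singleton_iff.1 hc, h4, h4', hab]

/-- The colors at the bottom crossing `e` before and after a third Reidemeister move. -/
def r3Color (c e : ℕ) (h : ℕ → R) : ℕ → R := Function.update h e (2 * h c - h e)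

theorem r3Color_r3Color {c e : ℕ} (hce : c ≠ e) (h : ℕ → R) : r3Color c e (r3Color c e h) = h := by
  unfold r3Color
  rw [Function.update_idem, Function.update_of_ne hce, Function.update_self, sub_sub_cancel,
    Function.update_eq_self]

/-- After the move the middle strand crosses the bottom one on the other side of its own underpass,
so its color at `e` is reflected in that of the top strand. On the bottom strand both orders give
the same translation. -/
theorem run_r3_pieces {c d e : ℕ} (hce : c ≠ e) (hde : d ≠ e) (εc εd εe σt σm σb : ℤˣ) (h : ℕ → R)
    (hcd : h c = h d) (p : List Endpoint)
    (hp : p ∈ [arrange σt ⟨c, true, εc⟩ ⟨d, true, εd⟩,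
         arrange σm ⟨c, false, εc⟩ ⟨e, true, εe⟩,
         arrange σb ⟨d, false, εd⟩ ⟨e, false, εe⟩]) (x y : R) :
    Run h x p y ↔ Run (r3Color c e h) x p.reverse y := by
  have hc' : r3Color c e h c = h c := Function.update_of_ne hce _ _
  have hd' : r3Color c e h d = h d := Function.update_of_ne hde _ _
  have he' : r3Color c e h e = 2 * h c - h e := Function.update_self _ _ _
  simp only [List.mem_cons, List.not_mem_nil, or_false] at hp
  rcases hp with rfl | rfl | rfl
  · rw [arrange_reverse, run_arrange_over _ rfl rfl, run_arrange_over _ rfl rfl]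
    simp only [hc', hd']
  · rcases Int.units_eq_one_or σm with rfl | rfl
    · simp only [arrange, if_true, List.reverse_cons, List.reverse_nil, List.nil_append,
        List.singleton_append, Run, Pass, hc', he', Bool.false_eq_true, if_false]
      constructor
      · rintro ⟨z, h1, _, ⟨rfl, h2⟩, rfl⟩
        exact ⟨x, ⟨rfl, by linear_combination -h1 - h2⟩, z, h1, rfl⟩
      · rintro ⟨_, ⟨rfl, h2⟩, z, h1, rfl⟩
        exact ⟨z, h1, z, ⟨rfl, by linear_combination -h1 - h2⟩, rfl⟩
    · simp only [arrange, show ((-1 : ℤˣ) = 1) = False from by decide, if_false, if_true,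
        List.reverse_cons, List.reverse_nil, List.nil_append,
        List.singleton_append, Run, Pass, hc', he', Bool.false_eq_true]
      constructor
      · rintro ⟨_, ⟨rfl, h2⟩, z, h1, rfl⟩
        exact ⟨z, h1, z, ⟨rfl, by linear_combination -h1 - h2⟩, rfl⟩
      · rintro ⟨z, h1, _, ⟨rfl, h2⟩, rfl⟩
        exact ⟨x, ⟨rfl, by linear_combination -h1 - h2⟩, z, h1, rfl⟩
  · rcases Int.units_eq_one_or σb with rfl | rfl
    · simp only [arrange, if_true, List.reverse_cons, List.reverse_nil, List.nil_append,
        List.singleton_append]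
      rw [run_pair_under rfl rfl, run_pair_under rfl rfl]
      simp only [hd', he', ← hcd]
      ring_nf
    · simp only [arrange, show ((-1 : ℤˣ) = 1) = False from by decide, if_false,
        List.reverse_cons, List.reverse_nil, List.nil_append, List.singleton_append]
      rw [run_pair_under rfl rfl, run_pair_under rfl rfl]
      simp only [hd', he', ← hcd]
      ring_nf

theorem ncard_colorings_of_r3 {D E : GaussDiagram} {w₀ w₁ w₂ w₃ p q r : List Endpoint} {c d e : ℕ}
    {εc εd εe σt σm σb : ℤˣ}
    (hperm : [p, q, r].Perm
        [arrange σt ⟨c, true, εc⟩ ⟨d, true, εd⟩,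
         arrange σm ⟨c, false, εc⟩ ⟨e, true, εe⟩,
         arrange σb ⟨d, false, εd⟩ ⟨e, false, εe⟩])
    (hD : D.word = w₀ ++ p ++ w₁ ++ q ++ w₂ ++ r ++ w₃)
    (hE : E.word = w₀ ++ p.reverse ++ w₁ ++ q.reverse ++ w₂ ++ r.reverse ++ w₃) :
    (colorings R D.word).ncard = (colorings R E.word).ncard := by
  have hperm' : D.word.Perm ([⟨c, true, εc⟩, ⟨d, true, εd⟩, ⟨c, false, εc⟩, ⟨e, true, εe⟩,
      ⟨d, false, εd⟩, ⟨e, false, εe⟩] ++ (w₀ ++ w₁ ++ w₂ ++ w₃)) := by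
    have h1 : D.word.Perm ([p, q, r].flatten ++ (w₀ ++ w₁ ++ w₂ ++ w₃)) := by
      rw [hD, List.perm_iff_count]
      intro x
      simp only [List.count_append, List.flatten_cons, List.flatten_nil, List.count_nil]
      omega
    refine h1.trans (List.Perm.append_right _ (hperm.flatten.trans ?_))
    simp only [List.flatten_cons, List.flatten_nil, List.append_nil]
    exact (arrange_perm _ _ _).append ((arrange_perm _ _ _).append (arrange_perm _ _ _))
  have hnd := hperm'.nodup_iff.1 D.nodup
  have hmem : ∀ a ∈ [(⟨c, true, εc⟩ : Endpoint), ⟨d, true, εd⟩, ⟨c, false, εc⟩, ⟨e, true, εe⟩,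
      ⟨d, false, εd⟩, ⟨e, false, εe⟩], a ∈ D.word := fun a ha =>
    hperm'.mem_iff.2 (List.mem_append_left _ ha)
  have hce : c ≠ e := by
    rintro rfl
    have := D.sign_eq ⟨c, true, εc⟩ (hmem _ (by simp)) ⟨c, true, εe⟩ (hmem _ (by simp)) rfl
    simp only at this
    subst this
    simp at hnd
  have hde : d ≠ e := by
    rintro rfl
    have := D.sign_eq ⟨d, true, εd⟩ (hmem _ (by simp)) ⟨d, true, εe⟩ (hmem _ (by simp)) rfl
    simp only at this
    subst this
    simp at hnd
  have hnot : ∀ a ∈ w₀ ++ w₁ ++ w₂ ++ w₃, a.chord ≠ e := by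
    refine D.chord_ne_of_perm (a := ⟨e, true, εe⟩)
      (w := [⟨c, true, εc⟩, ⟨d, true, εd⟩, ⟨c, false, εc⟩, ⟨d, false, εd⟩] ++ (w₀ ++ w₁ ++ w₂ ++ w₃))
      ?_ |> fun H a ha => H a (List.mem_append_right _ ha)
    refine hperm'.trans ?_
    rw [List.perm_iff_count]
    intro x
    simp only [List.count_append, List.count_cons, List.count_nil, Endpoint.opp, Bool.not_true]
    omega
  have hw : ∀ (h : ℕ → R) w, w ⊆ w₀ ++ w₁ ++ w₂ ++ w₃ → ∀ x y,
      Run h x w y ↔ Run (r3Color c e h) x w y := by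
    intro h w hw x y
    exact run_congr fun a ha => (Function.update_of_ne (hnot a (hw ha)) _ _).symm
  have htop : ∀ (h : ℕ → R) x y, Run h x (arrange σt ⟨c, true, εc⟩ ⟨d, true, εd⟩) y → h c = h d := by
    intro h x y hr
    rw [run_arrange_over _ rfl rfl] at hr
    exact hr.2.1.trans hr.2.2.symm
  have htop' : ∀ (h : ℕ → R) x y,
      Run (r3Color c e h) x (arrange σt ⟨c, true, εc⟩ ⟨d, true, εd⟩).reverse y → h c = h d := by
    intro h x y hr
    rw [run_reverse] at hr
    have := htop _ _ _ hr
    rwa [r3Color, Function.update_of_ne hce, Function.update_of_ne hde] at this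
  have hpm : p ∈ [p, q, r] := by simp
  have hqm : q ∈ [p, q, r] := by simp
  have hrm : r ∈ [p, q, r] := by simp
  have htm := hperm.mem_iff.2 (List.mem_cons_self)
  have hiff : ∀ (h : ℕ → R) x, Run h x D.word x ↔ Run (r3Color c e h) x E.word x := by
    intro h x
    -- The equality `h c = h d` is forced by the top strand in either diagram. The top strand may be
    -- any of `p`, `q`, `r`, whence the three cases below.
    have H : h c = h d → (Run h x D.word x ↔ Run (r3Color c e h) x E.word x) := by
      intro hcd
      have P := fun a (ha : a ∈ [p, q, r]) =>
        run_r3_pieces hce hde εc εd εe σt σm σb h hcd a (hperm.mem_iff.1 ha)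
      rw [hD, hE]
      simp only [run_append, P p hpm, P q hqm, P r hrm,
        hw h w₀ (fun a ha => by simp [ha]), hw h w₁ (fun a ha => by simp [ha]),
        hw h w₂ (fun a ha => by simp [ha]), hw h w₃ (fun a ha => by simp [ha])]
    constructor
    · intro hr
      refine (H ?_).1 hr
      rw [hD] at hr
      simp only [run_append] at hr
      obtain ⟨_, ⟨_, ⟨_, ⟨_, ⟨_, ⟨_, ⟨-, h1⟩⟩, -⟩, h2⟩, -⟩, h3⟩, -⟩ := hr
      simp only [List.mem_cons, List.not_mem_nil, or_false] at htm
      rcases htm with ht | ht | ht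
      · exact htop h _ _ (ht ▸ h1)
      · exact htop h _ _ (ht ▸ h2)
      · exact htop h _ _ (ht ▸ h3)
    · intro hr
      refine (H ?_).2 hr
      rw [hE] at hr
      simp only [run_append] at hr
      obtain ⟨_, ⟨_, ⟨_, ⟨_, ⟨_, ⟨_, ⟨-, h1⟩⟩, -⟩, h2⟩, -⟩, h3⟩, -⟩ := hr
      simp only [List.mem_cons, List.not_mem_nil, or_false] at htm
      rcases htm with ht | ht | ht
      · exact htop' h _ _ (ht ▸ h1)
      · exact htop' h _ _ (ht ▸ h2)
      · exact htop' h _ _ (ht ▸ h3)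
  have hDE : ∀ k, k ∈ D.word.map Endpoint.chord ↔ k ∈ E.word.map Endpoint.chord := by
    intro k
    rw [hD, hE]
    simp only [List.map_append, List.mem_append, List.map_reverse, List.mem_reverse]
  have heD : e ∈ D.word.map Endpoint.chord :=
    List.mem_map.2 ⟨⟨e, true, εe⟩, hmem _ (by simp), rfl⟩
  have hsup : ∀ (h : ℕ → R) k, k ∉ D.word.map Endpoint.chord → r3Color c e h k = h k := by
    intro h k hk
    refine Function.update_of_ne ?_ _ _
    rintro rfl
    exact hk heD
  refine Set.ncard_congr (fun q _ => (q.1, r3Color c e q.2)) ?_ ?_ ?_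
  · rintro ⟨x, h⟩ ⟨hs, hr⟩
    refine ⟨fun k hk => ?_, (hiff h x).1 hr⟩
    rw [← hDE] at hk
    exact (hsup h k hk).trans (hs k hk)
  · rintro ⟨x, h⟩ ⟨x', h'⟩ _ _ he
    simp only [Prod.mk.injEq] at he
    refine Prod.ext he.1 ?_
    rw [← r3Color_r3Color hce h, he.2, r3Color_r3Color hce]
  · rintro ⟨x, h⟩ ⟨hs, hr⟩
    refine ⟨(x, r3Color c e h), ⟨fun k hk => ?_, ?_⟩, ?_⟩
    · exact (hsup h k hk).trans (hs k (by rwa [← hDE]))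
    · rw [hiff, r3Color_r3Color hce]
      exact hr
    · simp only [r3Color_r3Color hce]

theorem Move.ncard_colorings {D E : GaussDiagram} (h : Move D E) :
    (colorings R D.word).ncard = (colorings R E.word).ncard := by
  cases h with
  | relabel f h => exact (ncard_colorings_of_relabel f h).symm
  | r1 u v a hD hE => exact (ncard_colorings_of_r1 hD hE).symm
  | r2 u v w a b τ hover hsign hD hE => exact (ncard_colorings_of_r2 hover hD hE).symm
  | r3 w₀ w₁ w₂ w₃ p q r c d e εc εd εe σt σm σb h₁ h₂ hperm hD hE =>
    exact ncard_colorings_of_r3 hperm hD hE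

end Coloring

end GaussDiagram

/-- The number of Fox colorings of a virtual knot with colors in `R`. -/
noncomputable def VirtualKnot.coloringNumber (R : Type*) [CommRing R] : VirtualKnot → ℕ :=
  Quot.lift (fun D => (GaussDiagram.colorings R D.word).ncard) fun _ _ h =>
    h.elim GaussDiagram.Move.ncard_colorings GaussDiagram.ncard_colorings_of_isRotated

theorem VirtualKnot.coloringNumber_mk (R : Type*) [CommRing R] (D : GaussDiagram) :
    VirtualKnot.coloringNumber R (VirtualKnot.mk D) = (GaussDiagram.colorings R D.word).ncard :=
  rfl

/-! ### Counting the orbits of a permutation. -/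

section Orbits

/-- Two relations whose quotients differ by one additional class, that of `y₀`. -/
theorem card_quot_eq_add_one {X Y : Type*} [Finite X] {r : X → X → Prop} {r' : Y → Y → Prop}
    (ι : X → Y) (F : Y → Option (Quot r)) (y₀ : Y)
    (h₁ : ∀ x x', r x x' → Quot.mk r' (ι x) = Quot.mk r' (ι x'))
    (h₂ : ∀ y y', r' y y' → F y = F y')
    (h₃ : ∀ x, F (ι x) = some (Quot.mk r x))
    (h₄ : ∀ y, (∃ x, F y = some (Quot.mk r x) ∧ Quot.mk r' y = Quot.mk r' (ι x)) ∨
      (F y = none ∧ Quot.mk r' y = Quot.mk r' y₀))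
    (h₅ : F y₀ = none) :
    Nat.card (Quot r') = Nat.card (Quot r) + 1 := by
  have : Finite (Quot r) := Finite.of_surjective (Quot.mk r) Quot.mk_surjective
  rw [← Finite.card_option]
  refine Nat.card_congr
    ⟨Quot.lift F h₂, fun o => o.elim (Quot.mk r' y₀) (Quot.lift (fun x => Quot.mk r' (ι x)) h₁), ?_, ?_⟩
  · rintro ⟨y⟩
    change Option.elim (F y) _ _ = Quot.mk r' y
    rcases h₄ y with ⟨x, hx, hy⟩ | ⟨hx, hy⟩
    · rw [hx, hy]
      rfl
    · rw [hx, hy]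
      rfl
  · rintro (_ | ⟨⟨x⟩⟩)
    · exact h₅
    · exact h₃ x

/-- Composition with a transposition of two points of the same orbit puts them into different
orbits. -/
theorem quot_mk_ne_of_swap {X : Type*} [Finite X] [DecidableEq X] (f : Equiv.Perm X) {a b : X}
    (hab : a ≠ b) (h : Quot.mk (fun x y => y = f x) a = Quot.mk (fun x y => y = f x) b) :
    Quot.mk (fun x y => y = f (Equiv.swap a b x)) b ≠
      Quot.mk (fun x y => y = f (Equiv.swap a b x)) a := by
  classical
  have hcyc : ∀ (g : Equiv.Perm X) (x y : X),
      Quot.mk (fun x y => y = g x) x = Quot.mk (fun x y => y = g x) y → g.SameCycle x y := by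
    intro g x y hxy
    have := Quot.eqvGen_exact hxy
    induction this with
    | rel x y h => exact ⟨1, by simp [h]⟩
    | refl x => exact Equiv.Perm.SameCycle.refl _ _
    | symm x y _ ih => exact (ih (Quot.eqvGen_sound ‹_›)).symm
    | trans x y z _ _ ih₁ ih₂ =>
      exact (ih₁ (Quot.eqvGen_sound ‹_›)).trans (ih₂ (Quot.eqvGen_sound ‹_›))
  have hk : ∃ k, (f ^ k) a = b := (hcyc f a b h).exists_nat_pow_eq
  have hk1 := Nat.find_spec hk
  have hk2 : ∀ m < Nat.find hk, (f ^ m) a ≠ b := fun m hm => Nat.find_min hk hm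
  generalize Nat.find hk = k at hk1 hk2
  have hk0 : 1 ≤ k := by
    rcases Nat.eq_zero_or_pos k with rfl | h
    · exact (hab (by simpa using hk1)).elim
    · exact h
  have hka : ∀ j, 1 ≤ j → j ≤ k → (f ^ j) a ≠ a := by
    intro j hj hjk hja
    refine hk2 (k - j) (by omega) ?_
    rw [← hk1]
    conv_rhs => rw [← Nat.sub_add_cancel hjk, pow_add, Equiv.Perm.mul_apply, hja]
  intro hba
  obtain ⟨m, hm⟩ := (hcyc (f * Equiv.swap a b) b a hba).exists_nat_pow_eq
  -- As `k` is the first time that `a` reaches `b`, the new orbit of `b` is `f a, …, f ^ k a = b`,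
  -- which avoids `a`.
  have hS : ∀ m : ℕ, ∃ j, 1 ≤ j ∧ j ≤ k ∧ (f ^ j) a = ((f * Equiv.swap a b) ^ m) b := by
    intro m
    induction m with
    | zero => exact ⟨k, hk0, le_rfl, by simpa using hk1⟩
    | succ m ih =>
      obtain ⟨j, hj, hjk, hjm⟩ := ih
      rw [pow_succ', Equiv.Perm.mul_apply, ← hjm]
      rcases hjk.eq_or_lt with rfl | hlt
      · exact ⟨1, le_rfl, hk0, by simp [hk1]⟩
      · refine ⟨j + 1, by omega, hlt, ?_⟩
        rw [Equiv.Perm.mul_apply, Equiv.swap_apply_of_ne_of_ne (hka j hj hjk) (hk2 j hlt), pow_succ',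
          Equiv.Perm.mul_apply]
  obtain ⟨j, hj, hjk, hjm⟩ := hS m
  exact hka j hj hjk (hjm.trans hm)

/-- A transposition of two points of one cycle cuts it in two. In the face count, this is a band
drawn across a face. -/
theorem card_quot_swap {X : Type*} [Finite X] [DecidableEq X] (f : Equiv.Perm X) {a b : X}
    (hab : a ≠ b) (h : Quot.mk (fun x y => y = f x) a = Quot.mk (fun x y => y = f x) b) :
    Nat.card (Quot (fun x y => y = f (Equiv.swap a b x))) =
      Nat.card (Quot (fun x y => y = f x)) + 1 := by
  classical
  set r : X → X → Prop := fun x y => y = f x with hr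
  set r' : X → X → Prop := fun x y => y = f (Equiv.swap a b x) with hr'
  have hne : Quot.mk r' b ≠ Quot.mk r' a := quot_mk_ne_of_swap f hab h
  have hf : ∀ x, Quot.mk r (f x) = Quot.mk r x := fun x => (Quot.sound (r := r) rfl).symm
  have hfa : Quot.mk r' (f a) = Quot.mk r' b := (Quot.sound (r := r') (by simp [hr'])).symm
  have hfb : Quot.mk r' (f b) = Quot.mk r' a := (Quot.sound (r := r') (by simp [hr'])).symm
  have hfx : ∀ x, x ≠ a → x ≠ b → Quot.mk r' (f x) = Quot.mk r' x := fun x ha hb =>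
    (Quot.sound (r := r') (by simp [hr', Equiv.swap_apply_of_ne_of_ne ha hb])).symm
  have hle : ∀ x y, r' x y → Quot.mk r x = Quot.mk r y := by
    rintro x y rfl
    rw [hf]
    by_cases hxa : x = a
    · subst hxa
      rw [Equiv.swap_apply_left, h]
    by_cases hxb : x = b
    · subst hxb
      rw [Equiv.swap_apply_right, h]
    rw [Equiv.swap_apply_of_ne_of_ne hxa hxb]
  have hle' : ∀ x y, Quot.mk r' x = Quot.mk r' y → Quot.mk r x = Quot.mk r y := fun x y hxy =>
    congrArg (Quot.lift (Quot.mk r) hle) hxy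
  -- The part with `a` stands for the old orbit and the part with `b` is the additional one, so
  -- points of the latter are sent to `a`.
  refine card_quot_eq_add_one (fun x => if Quot.mk r' x = Quot.mk r' b then a else x)
    (fun y => if Quot.mk r' y = Quot.mk r' b then none else some (Quot.mk r y)) b ?_ ?_ ?_ ?_ (by simp)
  · rintro x x' rfl
    by_cases hxa : x = a
    · subst hxa
      simp [hfa, hne.symm]
    by_cases hxb : x = b
    · subst hxb
      simp [hfb, hne.symm]
    rw [hfx x hxa hxb]
    split_ifs
    · rfl
    · exact (hfx x hxa hxb).symm
  · intro y y' hyy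
    have h1 : Quot.mk r' y = Quot.mk r' y' := Quot.sound hyy
    simp only [h1, hle _ _ hyy]
  · intro x
    by_cases hx : Quot.mk r' x = Quot.mk r' b
    · simp only [hx, if_true, hne.symm, if_false]
      rw [h, hle' x b hx]
    · simp only [hx, if_false]
  · intro y
    by_cases hy : Quot.mk r' y = Quot.mk r' b
    · right
      simp [hy]
    · left
      exact ⟨y, by simp [hy], by simp [hy]⟩

end Orbits

/-! ### Faces as orbits of half-edges. -/

namespace GaussDiagram

/-- A step around a face: follow an edge and turn at its end. -/
def step (D : GaussDiagram) (x : Endpoint × Bool) : Endpoint × Bool := turn (D.otherEnd x)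

/-- The face of a half-edge. -/
def face (D : GaussDiagram) (x : Endpoint × Bool) (hx : x.1 ∈ D.word) : D.Face := Quot.mk _ ⟨x, hx⟩

/-- Two half-edges belong to the same face. -/
def SameFace (D : GaussDiagram) (x y : Endpoint × Bool) : Prop :=
  ∃ hx hy, D.face x hx = D.face y hy

theorem SameFace.symm {D : GaussDiagram} {x y : Endpoint × Bool} : D.SameFace x y → D.SameFace y x :=
  fun ⟨hx, hy, h⟩ => ⟨hy, hx, h.symm⟩

theorem SameFace.trans {D : GaussDiagram} {x y z : Endpoint × Bool} :
    D.SameFace x y → D.SameFace y z → D.SameFace x z :=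
  fun ⟨hx, _, h⟩ ⟨_, hz, h'⟩ => ⟨hx, hz, h.trans h'⟩

theorem SameFace.refl {D : GaussDiagram} {x : Endpoint × Bool} (hx : x.1 ∈ D.word) : D.SameFace x x :=
  ⟨hx, hx, rfl⟩

theorem otherEnd_false (D : GaussDiagram) (e : Endpoint) :
    D.otherEnd (e, false) = (D.word.formPerm.symm e, true) := rfl

theorem otherEnd_otherEnd (D : GaussDiagram) (x : Endpoint × Bool) : D.otherEnd (D.otherEnd x) = x := by
  obtain ⟨e, _ | _⟩ := x <;> simp [otherEnd]

/-- Two quarter turns lead to the opposite half-edge, on the same strand. -/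
theorem turn_turn (x : Endpoint × Bool) : turn (turn x) = (x.1, !x.2) := by
  obtain ⟨⟨c, o, s⟩, b⟩ := x
  rcases Int.units_eq_one_or s with rfl | rfl <;> cases o <;> simp [turn, Endpoint.opp]

theorem turn_injective : Function.Injective turn := by
  intro x y h
  have := congrArg turn h
  rw [turn_turn, turn_turn] at this
  simpa [Prod.ext_iff] using this

theorem step_injective (D : GaussDiagram) : Function.Injective D.step :=
  turn_injective.comp (Function.Involutive.injective D.otherEnd_otherEnd)

theorem turn_mem (D : GaussDiagram) {x : Endpoint × Bool} (h : x.1 ∈ D.word) : (turn x).1 ∈ D.word := by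
  unfold turn
  split_ifs <;> exact D.opp_mem _ h

theorem otherEnd_mem (D : GaussDiagram) {x : Endpoint × Bool} (h : x.1 ∈ D.word) :
    (D.otherEnd x).1 ∈ D.word := by
  obtain ⟨e, _ | _⟩ := x
  · rw [otherEnd_false]
    refine List.mem_of_formPerm_apply_mem ?_
    simpa using h
  · exact List.formPerm_apply_mem_of_mem h

theorem step_mem (D : GaussDiagram) {x : Endpoint × Bool} (h : x.1 ∈ D.word) : (D.step x).1 ∈ D.word :=
  D.turn_mem (D.otherEnd_mem h)

instance (D : GaussDiagram) : Finite D.Dart := by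
  have : Finite {e // e ∈ D.word} := List.finite_toSet _
  exact Finite.of_injective (β := {e // e ∈ D.word} × Bool) (fun x => (⟨x.1.1, x.2⟩, x.1.2)) (by
    rintro ⟨⟨x, b⟩, hx⟩ ⟨⟨y, b'⟩, hy⟩ h
    simp only [Prod.mk.injEq, Subtype.mk.injEq] at h
    obtain ⟨rfl, rfl⟩ := h
    rfl)

/-- The permutation of the half-edges whose orbits are the faces. -/
noncomputable def stepPerm (D : GaussDiagram) : Equiv.Perm D.Dart :=
  Equiv.ofBijective (fun x => ⟨D.step x.1, D.step_mem x.2⟩) (Finite.injective_iff_bijective.1 (by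
    intro x y h
    exact Subtype.ext (D.step_injective (congrArg Subtype.val h))))

theorem card_face (D : GaussDiagram) : Nat.card D.Face = Nat.card (Quot (fun x y => y = D.stepPerm x)) := by
  have : (fun (x y : D.Dart) => (y : Endpoint × Bool) = turn (D.otherEnd x)) =
      fun x y => y = D.stepPerm x := by
    funext x y
    exact propext ⟨fun h => Subtype.ext h, fun h => congrArg Subtype.val h⟩
  unfold Face
  rw [this]

theorem face_step (D : GaussDiagram) {x : Endpoint × Bool} (hx : x.1 ∈ D.word) :
    D.face (D.step x) (D.step_mem hx) = D.face x hx :=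
  Eq.symm (Quot.sound (r := fun (x y : D.Dart) => (y : Endpoint × Bool) = turn (D.otherEnd x)) rfl)

theorem sameFace_step (D : GaussDiagram) {x : Endpoint × Bool} (hx : x.1 ∈ D.word) :
    D.SameFace x (D.step x) := ⟨hx, D.step_mem hx, (D.face_step hx).symm⟩

theorem face_congr (D : GaussDiagram) {x y : Endpoint × Bool} (hx : x.1 ∈ D.word) (h : x = y) :
    D.face x hx = D.face y (h ▸ hx) := by
  subst h
  rfl

/-- The endpoints at which the next half-edge counterclockwise after an outgoing one is outgoing. -/
def KeepsDirection (a : Endpoint) : Prop := a.isOver = true ↔ a.sign = 1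

theorem keepsDirection_opp {a : Endpoint} : KeepsDirection a.opp ↔ ¬ KeepsDirection a := by
  unfold KeepsDirection
  simp only [Endpoint.opp_isOver, Endpoint.opp_sign]
  cases a.isOver <;> simp

theorem turn_of_keepsDirection {a : Endpoint} (h : KeepsDirection a) (s : Bool) :
    turn (a, s) = (a.opp, s) := if_pos h

theorem turn_of_not_keepsDirection {a : Endpoint} (h : ¬ KeepsDirection a) (s : Bool) :
    turn (a, s) = (a.opp, !s) := if_neg h

end GaussDiagram

namespace GaussDiagram

theorem step_true (D : GaussDiagram) (e : Endpoint) : D.step (e, true) = turn (D.word.formPerm e, false) :=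
  rfl

theorem step_false (D : GaussDiagram) (e : Endpoint) :
    D.step (e, false) = turn (D.word.formPerm.symm e, true) := rfl

theorem nodup_of_isRotated (D : GaussDiagram) {w : List Endpoint} (h : D.word.IsRotated w) : w.Nodup :=
  h.nodup_iff.1 D.nodup

/-- New crossings subdivide edges, so a step in `D` may become several steps in `E`; it is enough
that they stay in one face. -/
theorem sameFace_mono {D E : GaussDiagram} (hsub : D.word ⊆ E.word)
    (h : ∀ x, ∀ hx : x.1 ∈ D.word,
      E.face x (hsub hx) = E.face (D.step x) (hsub (D.step_mem hx)))
    {x x' : Endpoint × Bool} : D.SameFace x x' → E.SameFace x x' := by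
  rintro ⟨hx, hx', he⟩
  refine ⟨hsub hx, hsub hx', ?_⟩
  have h' : ∀ x y : D.Dart, (y : Endpoint × Bool) = turn (D.otherEnd x) →
      E.face x.1 (hsub x.2) = E.face y.1 (hsub y.2) := by
    rintro ⟨x, hx⟩ ⟨y, hy⟩ rfl
    exact h x hx
  exact congrArg (Quot.lift (fun x : D.Dart => E.face x.1 (hsub x.2)) h') he

/-! ### Faces after the insertion of a kink. -/

section FirstMove

variable {D E : GaussDiagram} {a y : Endpoint} {l : List Endpoint}

/-- Each endpoint put at the front of a cyclic word multiplies the successor permutation by a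
transposition, so all successors can be computed. -/
theorem formPerm_of_r1 (hD : D.word.IsRotated (y :: l)) (hE : E.word.IsRotated (a :: a.opp :: y :: l)) :
    E.word.formPerm = Equiv.swap a a.opp * (Equiv.swap a.opp y * D.word.formPerm) := by
  rw [List.formPerm_eq_of_isRotated E.nodup hE, List.formPerm_eq_of_isRotated D.nodup hD,
    List.formPerm_cons_cons, List.formPerm_cons_cons]

/-- The number of faces of a diagram with a kink, and its faces near the kink. -/
theorem faces_of_r1 (hD : D.word.IsRotated (y :: l)) (hE : E.word.IsRotated (a :: a.opp :: y :: l)) :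
    Nat.card E.Face = Nat.card D.Face + 1 ∧ (∀ x x', D.SameFace x x' → E.SameFace x x') ∧
      (¬ KeepsDirection a → E.SameFace (y, false) (a, true)) ∧
      (KeepsDirection a → E.SameFace (D.word.formPerm.symm y, true) (a.opp, false)) := by
  classical
  have hψ := formPerm_of_r1 hD hE
  have hnd := E.nodup_of_isRotated hE
  have hmem : ∀ e, e ∈ D.word ↔ e ∈ y :: l := fun e => hD.perm.mem_iff
  have hmemE : ∀ e, e ∈ E.word ↔ e = a ∨ e = a.opp ∨ e ∈ D.word := fun e => by
    rw [hE.perm.mem_iff, hmem, List.mem_cons, List.mem_cons]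
  have ha : a ∉ D.word := by
    rw [hmem]
    simp only [List.nodup_cons, List.mem_cons, not_or] at hnd ⊢
    exact hnd.1.2
  have ha' : a.opp ∉ D.word := by
    rw [hmem]
    simp only [List.nodup_cons, List.mem_cons, not_or] at hnd ⊢
    exact hnd.2.1
  have hy : y ∈ D.word := by simp [hmem]
  set z := D.word.formPerm.symm y with hz
  have hzD : z ∈ D.word := D.otherEnd_mem (x := (y, false)) hy
  have hne : a.opp ≠ a := a.opp_ne
  have hya : y ≠ a := by rintro rfl; exact ha hy
  have hya' : y ≠ a.opp := by rintro rfl; exact ha' hy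
  have hsub : D.word ⊆ E.word := fun e he => (hmemE e).2 (Or.inr (Or.inr he))
  have haE : a ∈ E.word := by simp [hmemE]
  have haE' : a.opp ∈ E.word := by simp [hmemE]
  have hsymm : ∀ e, E.word.formPerm.symm e =
      D.word.formPerm.symm (Equiv.swap a.opp y (Equiv.swap a a.opp e)) := by
    intro e
    rw [Equiv.symm_apply_eq, hψ]
    simp
  have n1 : E.word.formPerm a = a.opp := by
    rw [hψ, Equiv.Perm.mul_apply, Equiv.Perm.mul_apply, List.formPerm_apply_of_notMem ha,
      Equiv.swap_apply_of_ne_of_ne hne.symm hya.symm, Equiv.swap_apply_left]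
  have n2 : E.word.formPerm a.opp = y := by
    rw [hψ, Equiv.Perm.mul_apply, Equiv.Perm.mul_apply, List.formPerm_apply_of_notMem ha',
      Equiv.swap_apply_left, Equiv.swap_apply_of_ne_of_ne hya hya']
  have n3 : E.word.formPerm z = a := by
    rw [hψ, Equiv.Perm.mul_apply, Equiv.Perm.mul_apply, hz, Equiv.apply_symm_apply,
      Equiv.swap_apply_right, Equiv.swap_apply_right]
  have n4 : ∀ e ∈ D.word, e ≠ z → E.word.formPerm e = D.word.formPerm e := by
    intro e he hez
    have h1 : D.word.formPerm e ∈ D.word := List.formPerm_apply_mem_of_mem he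
    have h2 : D.word.formPerm e ≠ y := fun h => hez (by rw [hz, ← h, Equiv.symm_apply_apply])
    rw [hψ, Equiv.Perm.mul_apply, Equiv.Perm.mul_apply,
      Equiv.swap_apply_of_ne_of_ne (ne_of_mem_of_not_mem h1 ha') h2,
      Equiv.swap_apply_of_ne_of_ne (ne_of_mem_of_not_mem h1 ha) (ne_of_mem_of_not_mem h1 ha')]
  have p1 : E.word.formPerm.symm a.opp = a := by rw [Equiv.symm_apply_eq, n1]
  have p2 : E.word.formPerm.symm y = a.opp := by rw [Equiv.symm_apply_eq, n2]
  have p3 : E.word.formPerm.symm a = z := by rw [Equiv.symm_apply_eq, n3]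
  have p4 : ∀ e ∈ D.word, e ≠ y → E.word.formPerm.symm e = D.word.formPerm.symm e := by
    intro e he hey
    rw [hsymm, Equiv.swap_apply_of_ne_of_ne (ne_of_mem_of_not_mem he ha) (ne_of_mem_of_not_mem he ha'),
      Equiv.swap_apply_of_ne_of_ne (ne_of_mem_of_not_mem he ha') hey]
  have hstep : ∀ x : Endpoint × Bool, x.1 ∈ D.word → x ≠ (y, false) → x ≠ (z, true) →
      E.step x = D.step x := by
    rintro ⟨e, _ | _⟩ he h1 h2
    · rw [step_false, step_false, p4 e he (by rintro rfl; exact h1 rfl)]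
    · rw [step_true, step_true, n4 e he (by rintro rfl; exact h2 rfl)]
  have hDy : D.step (y, false) = turn (z, true) := rfl
  have hDz : D.step (z, true) = turn (y, false) := by
    rw [step_true, hz, Equiv.apply_symm_apply]
  have hcases : ∀ x : Endpoint × Bool, x.1 ∈ E.word → x = (a, true) ∨ x = (a, false) ∨
      x = (a.opp, true) ∨ x = (a.opp, false) ∨ x = (y, false) ∨ x = (z, true) ∨
      (x.1 ∈ D.word ∧ E.step x = D.step x) := by
    rintro ⟨e, b⟩ he
    rcases (hmemE e).1 he with rfl | rfl | he
    · cases b <;> simp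
    · cases b <;> simp
    · by_cases h1 : (e, b) = (y, false)
      · tauto
      by_cases h2 : (e, b) = (z, true)
      · tauto
      have := hstep (e, b) he h1 h2
      tauto
  have hface : ∀ (x : Endpoint × Bool) (hx : x.1 ∈ E.word) x' (h : E.step x = x'),
      E.face x hx = E.face x' (h ▸ E.step_mem hx) := by
    rintro x hx _ rfl
    exact (E.face_step hx).symm
  -- The kink may curl to either side. The new face is a monogon, the half-edge fixed in `s6`; all
  -- other half-edges of the new crossing lie on old faces.
  by_cases hk : KeepsDirection a
  · have hk' : ¬ KeepsDirection a.opp := fun h => keepsDirection_opp.1 h hk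
    have t1 := turn_of_keepsDirection hk
    have t2 := turn_of_not_keepsDirection hk'
    simp only [Endpoint.opp_opp] at t2
    have s1 : E.step (y, false) = (a, false) := by rw [step_false, p2, t2]; rfl
    have s2 : E.step (a, false) = D.step (y, false) := by rw [step_false, p3, hDy]
    have s3 : E.step (z, true) = (a.opp, false) := by rw [step_true, n3, t1]
    have s4 : E.step (a.opp, false) = (a.opp, true) := by rw [step_false, p1, t1]
    have s5 : E.step (a.opp, true) = D.step (z, true) := by rw [step_true, n2, hDz]
    have s6 : E.step (a, true) = (a, true) := by rw [step_true, n1, t2]; rfl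
    have hold : ∀ x, ∀ hx : x.1 ∈ D.word,
        E.face x (hsub hx) = E.face (D.step x) (hsub (D.step_mem hx)) := by
      intro x hx
      rcases hcases x (hsub hx) with rfl | rfl | rfl | rfl | rfl | rfl | ⟨_, h⟩
      · exact (ha hx).elim
      · exact (ha hx).elim
      · exact (ha' hx).elim
      · exact (ha' hx).elim
      · exact (hface _ _ _ s1).trans (hface _ _ _ s2)
      · exact ((hface _ _ _ s3).trans (hface _ _ _ s4)).trans (hface _ _ _ s5)
      · exact hface _ _ _ h
    refine ⟨?_, fun x x' => sameFace_mono hsub hold, fun h => (h hk).elim,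
      fun _ => ⟨hsub hzD, haE', hface _ _ _ s3⟩⟩
    let N : Endpoint × Bool → Option D.Face := fun x =>
      if x = (a, true) then none else
        if x = (a, false) then some (D.face (y, false) hy) else some (D.face (z, true) hzD)
    let F : Endpoint × Bool → Option D.Face := fun x =>
      if h : x.1 ∈ D.word then some (D.face x h) else N x
    have f0 : ∀ x (h : x.1 ∈ D.word), F x = some (D.face x h) := fun x h => dif_pos h
    have f1 : F (a, true) = none := by simp [F, N, ha]
    have f2 : F (a, false) = some (D.face (y, false) hy) := by simp [F, N, ha]
    have f3 : F (a.opp, true) = some (D.face (z, true) hzD) := by simp [F, N, ha', hne]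
    have f4 : F (a.opp, false) = some (D.face (z, true) hzD) := by simp [F, N, ha', hne]
    have f5 : ∀ x (h : x.1 ∈ D.word), F (D.step x) = some (D.face x h) := fun x h => by
      rw [f0 _ (D.step_mem h), D.face_step h]
    refine card_quot_eq_add_one (X := D.Dart) (Y := E.Dart) (fun x => ⟨x.1, hsub x.2⟩) (fun x => F x.1)
      ⟨(a, true), haE⟩ ?_ ?_ ?_ ?_ f1
    · rintro ⟨x, hx⟩ ⟨x', hx'⟩ rfl
      exact hold x hx
    · rintro ⟨x, hx⟩ ⟨x', hx'⟩ rfl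
      change F x = F (E.step x)
      rcases hcases x hx with rfl | rfl | rfl | rfl | rfl | rfl | ⟨h', h⟩
      · rw [s6]
      · rw [s2, f2, f5 _ hy]
      · rw [s5, f3, f5 _ hzD]
      · rw [s4, f4, f3]
      · rw [s1, f2, f0]
      · rw [s3, f4, f0]
      · rw [h, f5 _ h', f0]
    · rintro ⟨x, hx⟩
      exact f0 x hx
    · rintro ⟨x, hx⟩
      rcases hcases x hx with rfl | rfl | rfl | rfl | rfl | rfl | ⟨h', h⟩
      · exact Or.inr ⟨f1, rfl⟩
      · exact Or.inl ⟨⟨(y, false), hy⟩, f2, (hface _ (hsub hy) _ s1).symm⟩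
      · exact Or.inl ⟨⟨(z, true), hzD⟩, f3,
          ((hface _ (hsub hzD) _ s3).trans (hface _ _ _ s4)).symm⟩
      · exact Or.inl ⟨⟨(z, true), hzD⟩, f4, (hface _ (hsub hzD) _ s3).symm⟩
      · exact Or.inl ⟨⟨_, hy⟩, f0 _ hy, rfl⟩
      · exact Or.inl ⟨⟨_, hzD⟩, f0 _ hzD, rfl⟩
      · exact Or.inl ⟨⟨_, h'⟩, f0 _ h', rfl⟩
  · have hk' : KeepsDirection a.opp := keepsDirection_opp.2 hk
    have t1 := turn_of_not_keepsDirection hk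
    have t2 := turn_of_keepsDirection hk'
    simp only [Endpoint.opp_opp] at t2
    have s1 : E.step (y, false) = (a, true) := by rw [step_false, p2, t2]
    have s2 : E.step (a, true) = (a, false) := by rw [step_true, n1, t2]
    have s3 : E.step (a, false) = D.step (y, false) := by rw [step_false, p3, hDy]
    have s4 : E.step (z, true) = (a.opp, true) := by rw [step_true, n3, t1]; rfl
    have s5 : E.step (a.opp, true) = D.step (z, true) := by rw [step_true, n2, hDz]
    have s6 : E.step (a.opp, false) = (a.opp, false) := by rw [step_false, p1, t1]; rfl
    have hold : ∀ x, ∀ hx : x.1 ∈ D.word,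
        E.face x (hsub hx) = E.face (D.step x) (hsub (D.step_mem hx)) := by
      intro x hx
      rcases hcases x (hsub hx) with rfl | rfl | rfl | rfl | rfl | rfl | ⟨_, h⟩
      · exact (ha hx).elim
      · exact (ha hx).elim
      · exact (ha' hx).elim
      · exact (ha' hx).elim
      · exact ((hface _ _ _ s1).trans (hface _ _ _ s2)).trans (hface _ _ _ s3)
      · exact (hface _ _ _ s4).trans (hface _ _ _ s5)
      · exact hface _ _ _ h
    refine ⟨?_, fun x x' => sameFace_mono hsub hold,
      fun _ => ⟨hsub hy, haE, hface _ _ _ s1⟩, fun h => (hk h).elim⟩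
    let N : Endpoint × Bool → Option D.Face := fun x =>
      if x = (a.opp, false) then none else
        if x = (a.opp, true) then some (D.face (z, true) hzD) else some (D.face (y, false) hy)
    let F : Endpoint × Bool → Option D.Face := fun x =>
      if h : x.1 ∈ D.word then some (D.face x h) else N x
    have f0 : ∀ x (h : x.1 ∈ D.word), F x = some (D.face x h) := fun x h => dif_pos h
    have f1 : F (a.opp, false) = none := by simp [F, N, ha']
    have f2 : F (a.opp, true) = some (D.face (z, true) hzD) := by simp [F, N, ha']
    have f3 : F (a, true) = some (D.face (y, false) hy) := by simp [F, N, ha, hne.symm]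
    have f4 : F (a, false) = some (D.face (y, false) hy) := by simp [F, N, ha, hne.symm]
    have f5 : ∀ x (h : x.1 ∈ D.word), F (D.step x) = some (D.face x h) := fun x h => by
      rw [f0 _ (D.step_mem h), D.face_step h]
    refine card_quot_eq_add_one (X := D.Dart) (Y := E.Dart) (fun x => ⟨x.1, hsub x.2⟩) (fun x => F x.1)
      ⟨(a.opp, false), haE'⟩ ?_ ?_ ?_ ?_ f1
    · rintro ⟨x, hx⟩ ⟨x', hx'⟩ rfl
      exact hold x hx
    · rintro ⟨x, hx⟩ ⟨x', hx'⟩ rfl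
      change F x = F (E.step x)
      rcases hcases x hx with rfl | rfl | rfl | rfl | rfl | rfl | ⟨h', h⟩
      · rw [s2, f3, f4]
      · rw [s3, f4, f5 _ hy]
      · rw [s5, f2, f5 _ hzD]
      · rw [s6]
      · rw [s1, f3, f0]
      · rw [s4, f2, f0]
      · rw [h, f5 _ h', f0]
    · rintro ⟨x, hx⟩
      exact f0 x hx
    · rintro ⟨x, hx⟩
      rcases hcases x hx with rfl | rfl | rfl | rfl | rfl | rfl | ⟨h', h⟩
      · exact Or.inl ⟨⟨(y, false), hy⟩, f3, (hface _ (hsub hy) _ s1).symm⟩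
      · exact Or.inl ⟨⟨(y, false), hy⟩, f4,
          ((hface _ (hsub hy) _ s1).trans (hface _ _ _ s2)).symm⟩
      · exact Or.inl ⟨⟨(z, true), hzD⟩, f2, (hface _ (hsub hzD) _ s4).symm⟩
      · exact Or.inr ⟨f1, rfl⟩
      · exact Or.inl ⟨⟨_, hy⟩, f0 _ hy, rfl⟩
      · exact Or.inl ⟨⟨_, hzD⟩, f0 _ hzD, rfl⟩
      · exact Or.inl ⟨⟨_, h'⟩, f0 _ h', rfl⟩

end FirstMove

/-! ### Faces after the insertion of two crossings between two edges of a face. -/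

section SecondMove

variable {D E : GaussDiagram} {a b y q : Endpoint} {v u : List Endpoint}

theorem formPerm_of_r2 (hD : D.word.IsRotated ((y :: v) ++ (q :: u)))
    (hE : E.word.IsRotated (a :: b :: (y :: v) ++ b.opp :: a.opp :: (q :: u))) :
    E.word.formPerm = Equiv.swap a b * (Equiv.swap b y * (Equiv.swap b.opp a.opp *
      (Equiv.swap a.opp q * D.word.formPerm))) := by
  have hnd := E.nodup_of_isRotated hE
  simp only [List.cons_append] at hE hnd
  have h1 : (y :: (v ++ b.opp :: a.opp :: q :: u)).IsRotated (b.opp :: a.opp :: q :: (u ++ (y :: v))) := by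
    have := List.isRotated_append (l := y :: v) (l' := b.opp :: a.opp :: q :: u)
    simpa using this
  have h2 : (q :: (u ++ (y :: v))).IsRotated D.word := by
    refine List.IsRotated.trans ?_ hD.symm
    have := List.isRotated_append (l := q :: u) (l' := y :: v)
    simpa using this
  rw [List.formPerm_eq_of_isRotated E.nodup hE, List.formPerm_cons_cons, List.formPerm_cons_cons,
    List.formPerm_eq_of_isRotated hnd.of_cons.of_cons h1, List.formPerm_cons_cons,
    List.formPerm_cons_cons, List.formPerm_eq_of_isRotated
      (h1.nodup_iff.1 hnd.of_cons.of_cons).of_cons.of_cons h2]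

/-- The number of faces after a second Reidemeister move, in any directions, between two edges of a
common face. -/
theorem faces_of_r2 (hD : D.word.IsRotated ((y :: v) ++ (q :: u)))
    (hE : E.word.IsRotated (a :: b :: (y :: v) ++ b.opp :: a.opp :: (q :: u)))
    (ka : KeepsDirection a) (kb : ¬ KeepsDirection b) (hyq : D.SameFace (y, false) (q, false)) :
    Nat.card E.Face = Nat.card D.Face + 2 ∧ E.SameFace (q, false) (a, false) := by
  classical
  have hψ := formPerm_of_r2 hD hE
  have hnd := E.nodup_of_isRotated hE
  have hp : (a :: b :: (y :: v) ++ b.opp :: a.opp :: (q :: u)).Perm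
      (a :: a.opp :: b :: b.opp :: ((y :: v) ++ (q :: u))) := by
    rw [List.perm_iff_count]
    intro x
    simp only [List.count_append, List.count_cons]
    omega
  have hndD := D.nodup_of_isRotated hD
  have hnd' := hp.nodup_iff.1 hnd
  have hmem : ∀ e, e ∈ D.word ↔ e ∈ (y :: v) ++ (q :: u) := fun e => hD.perm.mem_iff
  have hmemE : ∀ e, e ∈ E.word ↔ e = a ∨ e = a.opp ∨ e = b ∨ e = b.opp ∨ e ∈ D.word := fun e => by
    rw [hE.perm.mem_iff, hp.mem_iff, hmem, List.mem_cons, List.mem_cons, List.mem_cons, List.mem_cons]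
  obtain ⟨ha, ha', hb, hb'⟩ : a ∉ D.word ∧ a.opp ∉ D.word ∧ b ∉ D.word ∧ b.opp ∉ D.word := by
    rw [hmem, hmem, hmem, hmem]
    simp only [List.nodup_cons, List.mem_cons (b := a.opp), List.mem_cons (b := b),
      List.mem_cons (b := b.opp), not_or] at hnd'
    tauto
  obtain ⟨hab, hab', hba'⟩ : a ≠ b ∧ a ≠ b.opp ∧ a.opp ≠ b ∧ a.opp ≠ b.opp := by
    simp only [List.nodup_cons, List.mem_cons (b := a.opp), List.mem_cons (b := b),
      List.mem_cons (b := b.opp), not_or] at hnd'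
    tauto
  have hy : y ∈ D.word := by simp [hmem]
  have hq : q ∈ D.word := by simp [hmem]
  have hyq' : y ≠ q := by
    rintro rfl
    simp at hndD
  obtain ⟨hya, hya', hyb, hyb'⟩ : y ≠ a ∧ y ≠ a.opp ∧ y ≠ b ∧ y ≠ b.opp :=
    ⟨ne_of_mem_of_not_mem hy ha, ne_of_mem_of_not_mem hy ha', ne_of_mem_of_not_mem hy hb,
      ne_of_mem_of_not_mem hy hb'⟩
  obtain ⟨hqa, hqa', hqb, hqb'⟩ : q ≠ a ∧ q ≠ a.opp ∧ q ≠ b ∧ q ≠ b.opp :=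
    ⟨ne_of_mem_of_not_mem hq ha, ne_of_mem_of_not_mem hq ha', ne_of_mem_of_not_mem hq hb,
      ne_of_mem_of_not_mem hq hb'⟩
  have hao := a.opp_ne
  have hbo := b.opp_ne
  set zp := D.word.formPerm.symm y with hzp
  set zq := D.word.formPerm.symm q with hzq
  have hzpD : zp ∈ D.word := D.otherEnd_mem (x := (y, false)) hy
  have hzqD : zq ∈ D.word := D.otherEnd_mem (x := (q, false)) hq
  have hψp : D.word.formPerm zp = y := by simp [hzp]
  have hψq : D.word.formPerm zq = q := by simp [hzq]
  have hsub : D.word ⊆ E.word := fun e he => by simp [hmemE, he]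
  have haE : a ∈ E.word := by simp [hmemE]
  have hψ' : ∀ e, E.word.formPerm e = Equiv.swap a b (Equiv.swap b y (Equiv.swap b.opp a.opp
      (Equiv.swap a.opp q (D.word.formPerm e)))) := fun e => by rw [hψ]; rfl
  have n1 : E.word.formPerm a = b := by
    rw [hψ', List.formPerm_apply_of_notMem ha, Equiv.swap_apply_of_ne_of_ne hao.symm hqa.symm,
      Equiv.swap_apply_of_ne_of_ne hab' hao.symm, Equiv.swap_apply_of_ne_of_ne hab hya.symm,
      Equiv.swap_apply_left]
  have n2 : E.word.formPerm b = y := by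
    rw [hψ', List.formPerm_apply_of_notMem hb, Equiv.swap_apply_of_ne_of_ne hba'.1.symm hqb.symm,
      Equiv.swap_apply_of_ne_of_ne hbo.symm hba'.1.symm, Equiv.swap_apply_left,
      Equiv.swap_apply_of_ne_of_ne hya hyb]
  have n3 : E.word.formPerm b.opp = a.opp := by
    rw [hψ', List.formPerm_apply_of_notMem hb', Equiv.swap_apply_of_ne_of_ne hba'.2.symm hqb'.symm,
      Equiv.swap_apply_left, Equiv.swap_apply_of_ne_of_ne hba'.1 hya'.symm,
      Equiv.swap_apply_of_ne_of_ne hao hba'.1]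
  have n4 : E.word.formPerm a.opp = q := by
    rw [hψ', List.formPerm_apply_of_notMem ha', Equiv.swap_apply_left,
      Equiv.swap_apply_of_ne_of_ne hqb' hqa', Equiv.swap_apply_of_ne_of_ne hqb hyq'.symm,
      Equiv.swap_apply_of_ne_of_ne hqa hqb]
  have n5 : E.word.formPerm zp = a := by
    rw [hψ', hψp, Equiv.swap_apply_of_ne_of_ne hya' hyq', Equiv.swap_apply_of_ne_of_ne hyb' hya',
      Equiv.swap_apply_right, Equiv.swap_apply_right]
  have n6 : E.word.formPerm zq = b.opp := by
    rw [hψ', hψq, Equiv.swap_apply_right, Equiv.swap_apply_right,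
      Equiv.swap_apply_of_ne_of_ne hbo hyb'.symm, Equiv.swap_apply_of_ne_of_ne hab'.symm hbo]
  have n7 : ∀ e ∈ D.word, e ≠ zp → e ≠ zq → E.word.formPerm e = D.word.formPerm e := by
    intro e he hep heq
    have h1 : D.word.formPerm e ∈ D.word := List.formPerm_apply_mem_of_mem he
    have h2 : D.word.formPerm e ≠ y := fun h => hep (by rw [hzp, ← h, Equiv.symm_apply_apply])
    have h3 : D.word.formPerm e ≠ q := fun h => heq (by rw [hzq, ← h, Equiv.symm_apply_apply])
    rw [hψ', Equiv.swap_apply_of_ne_of_ne (ne_of_mem_of_not_mem h1 ha') h3,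
      Equiv.swap_apply_of_ne_of_ne (ne_of_mem_of_not_mem h1 hb') (ne_of_mem_of_not_mem h1 ha'),
      Equiv.swap_apply_of_ne_of_ne (ne_of_mem_of_not_mem h1 hb) h2,
      Equiv.swap_apply_of_ne_of_ne (ne_of_mem_of_not_mem h1 ha) (ne_of_mem_of_not_mem h1 hb)]
  have p7 : ∀ e ∈ D.word, e ≠ y → e ≠ q → E.word.formPerm.symm e = D.word.formPerm.symm e := by
    intro e he hey heq
    have he' : D.word.formPerm.symm e ∈ D.word := D.otherEnd_mem (x := (e, false)) he
    rw [Equiv.symm_apply_eq, n7 _ he', Equiv.apply_symm_apply]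
    · exact fun h => hey (D.word.formPerm.symm.injective h)
    · exact fun h => heq (D.word.formPerm.symm.injective h)
  have p1 : E.word.formPerm.symm b = a := by rw [Equiv.symm_apply_eq, n1]
  have p2 : E.word.formPerm.symm y = b := by rw [Equiv.symm_apply_eq, n2]
  have p3 : E.word.formPerm.symm a.opp = b.opp := by rw [Equiv.symm_apply_eq, n3]
  have p4 : E.word.formPerm.symm q = a.opp := by rw [Equiv.symm_apply_eq, n4]
  have p5 : E.word.formPerm.symm a = zp := by rw [Equiv.symm_apply_eq, n5]
  have p6 : E.word.formPerm.symm b.opp = zq := by rw [Equiv.symm_apply_eq, n6]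
  have hstep : ∀ x : Endpoint × Bool, x.1 ∈ D.word → x ≠ (y, false) → x ≠ (q, false) →
      x ≠ (zp, true) → x ≠ (zq, true) → E.step x = D.step x := by
    rintro ⟨e, _ | _⟩ he h1 h2 h3 h4
    · rw [step_false, step_false, p7 e he (by rintro rfl; exact h1 rfl) (by rintro rfl; exact h2 rfl)]
    · rw [step_true, step_true, n7 e he (by rintro rfl; exact h3 rfl) (by rintro rfl; exact h4 rfl)]
  have ka' : ¬ KeepsDirection a.opp := fun h => keepsDirection_opp.1 h ka
  have kb' : KeepsDirection b.opp := keepsDirection_opp.2 kb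
  have ta := turn_of_keepsDirection ka
  have ta' := turn_of_not_keepsDirection ka'
  have tb := turn_of_not_keepsDirection kb
  have tb' := turn_of_keepsDirection kb'
  simp only [Endpoint.opp_opp] at ta' tb'
  -- By `s1` to `s4` the successors of `(y, false)` and `(q, false)` are exchanged, by `s5` to `s10`
  -- the other sides of the two edges are only subdivided, and `s11`, `s12` form the new bigon.
  have s1 : E.step (y, false) = (b.opp, false) := by rw [step_false, p2, tb]; rfl
  have s2 : E.step (b.opp, false) = D.step (q, false) := by rw [step_false, p6]; rfl
  have s3 : E.step (q, false) = (a, false) := by rw [step_false, p4, ta']; rfl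
  have s4 : E.step (a, false) = D.step (y, false) := by rw [step_false, p5]; rfl
  have s5 : E.step (zp, true) = (a.opp, false) := by rw [step_true, n5, ta]
  have s6 : E.step (a.opp, false) = (b, true) := by rw [step_false, p3, tb']
  have s7 : E.step (b, true) = D.step (zp, true) := by rw [step_true, n2, step_true, hψp]
  have s8 : E.step (zq, true) = (b, false) := by rw [step_true, n6, tb']
  have s9 : E.step (b, false) = (a.opp, true) := by rw [step_false, p1, ta]
  have s10 : E.step (a.opp, true) = D.step (zq, true) := by rw [step_true, n4, step_true, hψq]
  have s11 : E.step (b.opp, true) = (a, true) := by rw [step_true, n3, ta']; rfl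
  have s12 : E.step (a, true) = (b.opp, true) := by rw [step_true, n1, tb]; rfl
  have hcases : ∀ x : Endpoint × Bool, x.1 ∈ E.word → x = (a, true) ∨ x = (a, false) ∨
      x = (a.opp, true) ∨ x = (a.opp, false) ∨ x = (b, true) ∨ x = (b, false) ∨
      x = (b.opp, true) ∨ x = (b.opp, false) ∨
      x = (y, false) ∨ x = (q, false) ∨ x = (zp, true) ∨ x = (zq, true) ∨
      (x.1 ∈ D.word ∧ x ≠ (y, false) ∧ x ≠ (q, false) ∧ E.step x = D.step x) := by
    rintro ⟨e, s⟩ he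
    rcases (hmemE e).1 he with rfl | rfl | rfl | rfl | he
    · cases s <;> simp
    · cases s <;> simp
    · cases s <;> simp
    · cases s <;> simp
    · by_cases h1 : (e, s) = (y, false)
      · iterate 8 right
        exact Or.inl h1
      by_cases h2 : (e, s) = (q, false)
      · iterate 9 right
        exact Or.inl h2
      by_cases h3 : (e, s) = (zp, true)
      · iterate 10 right
        exact Or.inl h3
      by_cases h4 : (e, s) = (zq, true)
      · iterate 11 right
        exact Or.inl h4
      iterate 12 right
      exact ⟨he, h1, h2, hstep (e, s) he h1 h2 h3 h4⟩
  have hface : ∀ (x : Endpoint × Bool) (hx : x.1 ∈ E.word) x' (h : E.step x = x'),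
      E.face x hx = E.face x' (h ▸ E.step_mem hx) := by
    rintro x hx _ rfl
    exact (E.face_step hx).symm
  refine ⟨?_, ⟨hsub hq, haE, hface _ _ _ s3⟩⟩
  let Y : D.Dart := ⟨(y, false), hy⟩
  let Q : D.Dart := ⟨(q, false), hq⟩
  have hYQ : Y ≠ Q := fun h => hyq' (congrArg (fun x : D.Dart => x.1.1) h)
  have hsame : Quot.mk (fun x y => y = D.stepPerm x) Y = Quot.mk (fun x y => y = D.stepPerm x) Q := by
    obtain ⟨_, _, h⟩ := hyq
    have hr : ∀ x z : D.Dart, (z : Endpoint × Bool) = turn (D.otherEnd x) → z = D.stepPerm x :=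
      fun x z h => Subtype.ext h
    exact congrArg (Quot.lift (Quot.mk (fun x y => y = D.stepPerm x)) fun x z h =>
      Quot.sound (hr x z h)) h
  -- One of the two new faces comes from splitting the common face of the two edges, the other is
  -- the bigon.
  have hcount := card_quot_swap D.stepPerm hYQ hsame
  rw [← card_face] at hcount
  let r : D.Dart → D.Dart → Prop := fun x y => y = D.stepPerm (Equiv.swap Y Q x)
  rw [show Nat.card D.Face + 2 = Nat.card D.Face + 1 + 1 from rfl, ← hcount]
  let g : ∀ x : Endpoint × Bool, x.1 ∈ D.word → Quot r := fun x hx => Quot.mk r ⟨x, hx⟩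
  have gY : g (D.step (q, false)) (D.step_mem hq) = g (y, false) hy := by
    refine (Quot.sound (r := r) ?_).symm
    change _ = D.stepPerm (Equiv.swap Y Q Y)
    rw [Equiv.swap_apply_left]
    rfl
  have gQ : g (D.step (y, false)) (D.step_mem hy) = g (q, false) hq := by
    refine (Quot.sound (r := r) ?_).symm
    change _ = D.stepPerm (Equiv.swap Y Q Q)
    rw [Equiv.swap_apply_right]
    rfl
  have gX : ∀ x hx, x ≠ (y, false) → x ≠ (q, false) → g (D.step x) (D.step_mem hx) = g x hx := by
    intro x hx h1 h2
    refine (Quot.sound (r := r) ?_).symm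
    change _ = D.stepPerm (Equiv.swap Y Q ⟨x, hx⟩)
    rw [Equiv.swap_apply_of_ne_of_ne (fun h => h1 (congrArg Subtype.val h))
      (fun h => h2 (congrArg Subtype.val h))]
    rfl
  have hold : ∀ x z : D.Dart, r x z → E.face x.1 (hsub x.2) = E.face z.1 (hsub z.2) := by
    rintro ⟨x, hx⟩ z hxz
    have hz : ∀ x', Equiv.swap Y Q ⟨x, hx⟩ = x' → z.1 = D.step x'.1 := by
      rintro _ rfl
      exact congrArg Subtype.val hxz
    have hz' : ∀ x', x ≠ (y, false) → x ≠ (q, false) → D.step x = x' → z.1 = x' := by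
      rintro _ h1 h2 rfl
      exact hz ⟨x, hx⟩ (Equiv.swap_apply_of_ne_of_ne (fun h => h1 (congrArg Subtype.val h))
        (fun h => h2 (congrArg Subtype.val h)))
    obtain ⟨z, hzD⟩ := z
    rcases hcases x (hsub hx) with rfl | rfl | rfl | rfl | rfl | rfl | rfl | rfl | rfl | rfl | rfl |
      rfl | ⟨_, h1, h2, h⟩
    · exact (ha hx).elim
    · exact (ha hx).elim
    · exact (ha' hx).elim
    · exact (ha' hx).elim
    · exact (hb hx).elim
    · exact (hb hx).elim
    · exact (hb' hx).elim
    · exact (hb' hx).elim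
    · obtain rfl : z = D.step (q, false) := hz Q (Equiv.swap_apply_left Y Q)
      exact (hface _ _ _ s1).trans (hface _ _ _ s2)
    · obtain rfl : z = D.step (y, false) := hz Y (Equiv.swap_apply_right Y Q)
      exact (hface _ _ _ s3).trans (hface _ _ _ s4)
    · obtain rfl : z = D.step (zp, true) := hz' _ (by simp) (by simp) rfl
      exact ((hface _ _ _ s5).trans (hface _ _ _ s6)).trans (hface _ _ _ s7)
    · obtain rfl : z = D.step (zq, true) := hz' _ (by simp) (by simp) rfl
      exact ((hface _ _ _ s8).trans (hface _ _ _ s9)).trans (hface _ _ _ s10)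
    · obtain rfl : z = D.step x := hz' _ h1 h2 rfl
      exact hface _ _ _ h
  let N : Endpoint × Bool → Option (Quot r) := fun x =>
    if x = (b.opp, true) ∨ x = (a, true) then none else
      if x = (b.opp, false) then some (g (y, false) hy) else
        if x = (a, false) then some (g (q, false) hq) else
          if x = (a.opp, false) ∨ x = (b, true) then some (g (zp, true) hzpD) else
            some (g (zq, true) hzqD)
  let F : Endpoint × Bool → Option (Quot r) := fun x =>
    if h : x.1 ∈ D.word then some (g x h) else N x
  have f0 : ∀ x (h : x.1 ∈ D.word), F x = some (g x h) := fun x h => dif_pos h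
  have f1 : F (b.opp, true) = none := by simp [F, N, hb']
  have f2 : F (a, true) = none := by simp [F, N, ha]
  have f3 : F (b.opp, false) = some (g (y, false) hy) := by simp [F, N, hb']
  have f4 : F (a, false) = some (g (q, false) hq) := by simp [F, N, ha, hab']
  have f5 : F (a.opp, false) = some (g (zp, true) hzpD) := by simp [F, N, ha', hba'.2, hao]
  have f6 : F (b, true) = some (g (zp, true) hzpD) := by
    simp [F, N, hb, hbo.symm, hab.symm]
  have f7 : F (b, false) = some (g (zq, true) hzqD) := by
    simp [F, N, hb, hbo.symm, hab.symm, hba'.1.symm]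
  have f8 : F (a.opp, true) = some (g (zq, true) hzqD) := by
    simp [F, N, ha', hba'.2, hao, hba'.1]
  refine card_quot_eq_add_one (X := D.Dart) (Y := E.Dart) (r := r) (fun x => ⟨x.1, hsub x.2⟩)
    (fun x => F x.1) ⟨(a, true), haE⟩ hold ?_ ?_ ?_ f2
  · rintro ⟨x, hx⟩ ⟨x', hx'⟩ rfl
    change F x = F (E.step x)
    rcases hcases x hx with rfl | rfl | rfl | rfl | rfl | rfl | rfl | rfl | rfl | rfl | rfl |
      rfl | ⟨h', h1, h2, h⟩
    · rw [s12, f2, f1]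
    · rw [s4, f4, f0 _ (D.step_mem hy), gQ]
    · rw [s10, f8, f0 _ (D.step_mem hzqD), gX _ hzqD (by simp) (by simp)]
    · rw [s6, f5, f6]
    · rw [s7, f6, f0 _ (D.step_mem hzpD), gX _ hzpD (by simp) (by simp)]
    · rw [s9, f7, f8]
    · rw [s11, f1, f2]
    · rw [s2, f3, f0 _ (D.step_mem hq), gY]
    · rw [s1, f3, f0]
    · rw [s3, f4, f0]
    · rw [s5, f5, f0]
    · rw [s8, f7, f0]
    · rw [h, f0 _ (D.step_mem h'), gX _ h' h1 h2, f0]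
  · rintro ⟨x, hx⟩
    exact f0 x hx
  · rintro ⟨x, hx⟩
    rcases hcases x hx with rfl | rfl | rfl | rfl | rfl | rfl | rfl | rfl | rfl | rfl | rfl |
      rfl | ⟨h', h1, h2, h⟩
    · exact Or.inr ⟨f2, rfl⟩
    · exact Or.inl ⟨⟨(q, false), hq⟩, f4, (hface _ (hsub hq) _ s3).symm⟩
    · exact Or.inl ⟨⟨(zq, true), hzqD⟩, f8,
        ((hface _ (hsub hzqD) _ s8).trans (hface _ _ _ s9)).symm⟩
    · exact Or.inl ⟨⟨(zp, true), hzpD⟩, f5, (hface _ (hsub hzpD) _ s5).symm⟩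
    · exact Or.inl ⟨⟨(zp, true), hzpD⟩, f6,
        ((hface _ (hsub hzpD) _ s5).trans (hface _ _ _ s6)).symm⟩
    · exact Or.inl ⟨⟨(zq, true), hzqD⟩, f7, (hface _ (hsub hzqD) _ s8).symm⟩
    · exact Or.inr ⟨f1, hface _ _ _ s11⟩
    · exact Or.inl ⟨⟨(y, false), hy⟩, f3, (hface _ (hsub hy) _ s1).symm⟩
    · exact Or.inl ⟨⟨_, hy⟩, f0 _ hy, rfl⟩
    · exact Or.inl ⟨⟨_, hq⟩, f0 _ hq, rfl⟩
    · exact Or.inl ⟨⟨_, hzpD⟩, f0 _ hzpD, rfl⟩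
    · exact Or.inl ⟨⟨_, hzqD⟩, f0 _ hzqD, rfl⟩
    · exact Or.inl ⟨⟨_, h'⟩, f0 _ h', rfl⟩

end SecondMove

end GaussDiagram

/-! ### Alternating sums over unions of sets. -/

section AlternatingSums

variable {G : Type*} [AddCommGroup G]

/-- The alternating sum of the values of `f` at the unions of `t` with some of the sets of a list. -/
def altSum (f : Finset ℕ → G) : List (Finset ℕ) → Finset ℕ → G
  | [], t => f t
  | A :: As, t => altSum f As t - altSum f As (t ∪ A)

theorem altSum_empty_set (f : Finset ℕ → G) (Bs As : List (Finset ℕ)) (t : Finset ℕ) :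
    altSum f (Bs ++ ∅ :: As) t = 0 := by
  induction Bs generalizing t with
  | nil => simp [altSum]
  | cons B Bs ih => simp [altSum, ih]

/-- With a formal factor `1 - x_A` for each set, this is `1 - x_c x_A = (1 - x_c) + x_c (1 - x_A)`.
-/
theorem altSum_insert (f : Finset ℕ → G) (Bs As : List (Finset ℕ)) (c : ℕ) (A t : Finset ℕ) :
    altSum f (Bs ++ insert c A :: As) t =
      altSum f (Bs ++ {c} :: As) t + altSum f (Bs ++ A :: As) (t ∪ {c}) := by
  induction Bs generalizing t with
  | nil =>
    have : t ∪ insert c A = t ∪ {c} ∪ A := by rw [Finset.insert_eq, Finset.union_assoc]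
    simp [altSum, this]
  | cons B Bs ih =>
    simp only [List.cons_append, altSum, ih, Finset.union_right_comm t B {c}]
    abel

theorem altSum_singletons (f : Finset ℕ → G) (l : List ℕ) (hl : l.Nodup) (t : Finset ℕ) :
    altSum f (l.map fun c => {c}) t =
      ∑ s ∈ l.toFinset.powerset, (-1 : ℤ) ^ s.card • f (t ∪ s) := by
  induction l generalizing t with
  | nil => simp [altSum]
  | cons c l ih =>
    have hc : c ∉ l.toFinset := by simpa using (List.nodup_cons.1 hl).1
    rw [List.toFinset_cons, Finset.sum_powerset_insert hc, List.map_cons, altSum,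
      ih (List.nodup_cons.1 hl).2, ih (List.nodup_cons.1 hl).2, sub_eq_add_neg, ← Finset.sum_neg_distrib]
    congr 1
    refine Finset.sum_congr rfl fun s hs => ?_
    have hcs : c ∉ s := fun h => hc (Finset.mem_powerset.1 hs h)
    rw [Finset.card_insert_of_notMem hcs, pow_succ, mul_neg_one, neg_smul, Finset.insert_eq,
      Finset.union_assoc]

/-- By `altSum_insert` every set is used up element by element. Each element either becomes a
singleton, collected in `l`, or is absorbed into `t`; an exhausted set contributes zero.
Disjointness keeps the singletons distinct and outside `t`. -/
theorem altSum_eq_zero_of_singletons (f : Finset ℕ → G) (X : Finset ℕ) (n : ℕ)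
    (hf : ∀ (l : List ℕ) (t : Finset ℕ), l.Nodup → l.length = n → (∀ c ∈ l, c ∈ X ∧ c ∉ t) →
      altSum f (l.map fun c => {c}) t = 0)
    (As : List (Finset ℕ)) (l : List ℕ) (t : Finset ℕ) (hl : l.Nodup) (hn : l.length + As.length = n)
    (hlt : ∀ c ∈ l, c ∈ X ∧ c ∉ t) (hd : As.Pairwise Disjoint)
    (hA : ∀ A ∈ As, ∀ c ∈ A, c ∈ X ∧ c ∉ t ∧ c ∉ l) :
    altSum f ((l.map fun c => {c}) ++ As) t = 0 := by
  induction As generalizing l t with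
  | nil =>
    rw [List.append_nil]
    exact hf l t hl (by simpa using hn) hlt
  | cons A As ih =>
    have hd' := List.pairwise_cons.1 hd
    have hAs : ∀ B ∈ As, ∀ c ∈ B, c ∈ X ∧ c ∉ t ∧ c ∉ l := fun B hB => hA B (by simp [hB])
    have hA0 := hA A (by simp)
    have hAB := hd'.1
    clear hA hd
    induction A using Finset.induction generalizing t with
    | empty => exact altSum_empty_set _ _ _ _
    | insert c A hc ihA =>
      have hcl := hA0 c (by simp)
      have hcAs : ∀ B ∈ As, c ∉ B := fun B hB h =>
        Finset.disjoint_left.1 (hAB B hB) (Finset.mem_insert_self c A) h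
      rw [altSum_insert]
      have h1 : altSum f ((l.map fun c => {c}) ++ {c} :: As) t = 0 := by
        have := ih (l ++ [c]) t ?_ ?_ ?_ hd'.2 ?_
        · simpa using this
        · rw [List.nodup_append]
          refine ⟨hl, by simp, ?_⟩
          intro a ha b hb
          rw [List.mem_singleton] at hb
          subst hb
          rintro rfl
          exact hcl.2.2 ha
        · simp only [List.length_append, List.length_cons, List.length_nil] at hn ⊢
          omega
        · intro d hdl
          rcases List.mem_append.1 hdl with h | h
          · exact hlt d h
          · rw [List.mem_singleton.1 h]
            exact ⟨hcl.1, hcl.2.1⟩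
        · intro B hB d hdB
          refine ⟨(hAs B hB d hdB).1, (hAs B hB d hdB).2.1, ?_⟩
          rw [List.mem_append, List.mem_singleton, not_or]
          refine ⟨(hAs B hB d hdB).2.2, ?_⟩
          rintro rfl
          exact hcAs B hB hdB
      rw [h1, zero_add]
      have hdis : ∀ B ∈ As, Disjoint A B := fun B hB =>
        Finset.disjoint_of_subset_left (Finset.subset_insert _ _) (hAB B hB)
      refine ihA _ (by simpa using hn) ?_ ⟨hdis, hd'.2⟩ ?_ ?_ hdis
      · intro d hdl
        refine ⟨(hlt d hdl).1, ?_⟩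
        rw [Finset.mem_union, Finset.mem_singleton, not_or]
        refine ⟨(hlt d hdl).2, ?_⟩
        rintro rfl
        exact hcl.2.2 hdl
      · intro B hB d hdB
        refine ⟨(hAs B hB d hdB).1, ?_, (hAs B hB d hdB).2.2⟩
        rw [Finset.mem_union, Finset.mem_singleton, not_or]
        refine ⟨(hAs B hB d hdB).2.1, ?_⟩
        rintro rfl
        exact hcAs B hB hdB
      · intro d hdA
        have := hA0 d (by simp [hdA])
        refine ⟨this.1, ?_, this.2.2⟩
        rw [Finset.mem_union, Finset.mem_singleton, not_or]
        refine ⟨this.2.1, ?_⟩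
        rintro rfl
        exact hc hdA

theorem altSum_eq_zero_of_const (f : Finset ℕ → G) (k : G) (P : Finset ℕ → Prop)
    (hP : ∀ t, P t → f t = k) (As : List (Finset ℕ)) (hA : ∀ t, P t → ∀ A ∈ As, P (t ∪ A))
    (hne : As ≠ []) (t : Finset ℕ) (ht : P t) : altSum f As t = 0 := by
  induction As generalizing t with
  | nil => exact (hne rfl).elim
  | cons A As ih =>
    have htA := hA t ht A (by simp)
    rw [altSum]
    by_cases h : As = []
    · subst h
      rw [altSum, altSum, hP t ht, hP _ htA, sub_self]
    · have hA' : ∀ t, P t → ∀ A ∈ As, P (t ∪ A) := fun t ht B hB => hA t ht B (by simp [hB])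
      rw [ih hA' h t ht, ih hA' h _ htA, sub_self]

/-- All terms except that of `t` itself equal `k`, and the coefficients add up to zero. -/
theorem altSum_eq_sub_of_const (f : Finset ℕ → G) (k : G) (P : Finset ℕ → Prop)
    (hP : ∀ t, P t → f t = k) (t : Finset ℕ) (As : List (Finset ℕ))
    (hA : ∀ t, P t → ∀ A ∈ As, P (t ∪ A)) (hA₀ : ∀ A ∈ As, P (t ∪ A))
    (hne : As ≠ []) : altSum f As t = f t - k := by
  induction As with
  | nil => exact (hne rfl).elim
  | cons A As ih =>
    have htA := hA₀ A (by simp)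
    rw [altSum]
    by_cases h : As = []
    · subst h
      rw [altSum, altSum, hP _ htA]
    · have hA' : ∀ t, P t → ∀ A ∈ As, P (t ∪ A) := fun t ht B hB => hA t ht B (by simp [hB])
      rw [ih hA' (fun B hB => hA₀ B (by simp [hB])) h,
        altSum_eq_zero_of_const f k P hP As hA' h _ htA, sub_zero]

end AlternatingSums

/-! ### Invariants of bounded order and disjoint sets of crossings. -/

namespace GaussDiagram

/-- An invariant of order less than `n` does not distinguish a diagram from its virtualizations, if
there are `n` disjoint sets of crossings such that virtualizing any nonempty union of them has the same
effect. -/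
theorem GPVOrderLE.eq_of_sets {G : Type*} [AddCommGroup G] {v : GaussDiagram → G} {m : ℕ}
    (hv : GPVOrderLE v m) (D : GaussDiagram) (A : ℕ → Finset ℕ) (hA : ∀ i, A i ⊆ D.chords)
    (hd : Pairwise fun i j => Disjoint (A i) (A j)) (k : G)
    (hk : ∀ S : Finset ℕ, S ⊆ Finset.range (m + 1) → S.Nonempty → v (D.virtualize (S.biUnion A)) = k) :
    v D = k := by
  classical
  set f : Finset ℕ → G := fun t => v (D.virtualize t) with hf
  -- The same alternating sum over `m + 1` sets is evaluated twice: it vanishes by the bound on the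
  -- order, and it is `f ∅ - k` because only the empty union differs from `k`.
  have h1 : altSum f ((List.range (m + 1)).map A) ∅ = 0 := by
    refine altSum_eq_zero_of_singletons f D.chords (m + 1) ?_ _ [] ∅ List.nodup_nil (by simp) (by simp)
      ?_ ?_
    · intro l t hl hln hlt
      rw [altSum_singletons f l hl t]
      have := hv (D.virtualize t) l.toFinset ?_ ?_
      · simpa only [virtualize_virtualize] using this
      · intro c hc
        rw [chords_virtualize, Finset.mem_sdiff]
        exact hlt c (by simpa using hc)
      · rw [List.toFinset_card_of_nodup hl, hln]
    · exact List.Pairwise.map _ (fun i j (h : i ≠ j) => hd h) List.nodup_range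
    · intro B hB c hc
      obtain ⟨i, -, rfl⟩ := List.mem_map.1 hB
      exact ⟨hA i hc, by simp, by simp⟩
  have h2 : altSum f ((List.range (m + 1)).map A) ∅ = f ∅ - k := by
    refine altSum_eq_sub_of_const f k
      (fun t => ∃ S : Finset ℕ, S ⊆ Finset.range (m + 1) ∧ S.Nonempty ∧ t = S.biUnion A) ?_ ∅ _ ?_ ?_
      (by simp)
    · rintro _ ⟨S, hS, hS', rfl⟩
      exact hk S hS hS'
    · rintro _ ⟨S, hS, hS', rfl⟩ B hB
      obtain ⟨i, hi, rfl⟩ := List.mem_map.1 hB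
      refine ⟨insert i S, ?_, by simp, ?_⟩
      · exact Finset.insert_subset (by simpa using hi) hS
      · rw [Finset.biUnion_insert, Finset.union_comm]
    · intro B hB
      obtain ⟨i, hi, rfl⟩ := List.mem_map.1 hB
      exact ⟨{i}, by simpa using hi, by simp, by simp⟩
  rw [h1] at h2
  have h3 := sub_eq_zero.1 h2.symm
  simpa [hf, virtualize_empty] using h3

/-! ### Clasps, tangles and free reduction. -/

/-- The endpoints, on the strand of lower number, of the two arrows of a clasp. The clasp
`((i, b), k)` has arrows `2 * k` and `2 * k + 1`, it is the inverse of `((i, !b), k')`, and it connects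
the second and the third strand if `i = 0` and the first and the second strand otherwise. -/
def lower (c : (ℕ × Bool) × ℕ) : List Endpoint :=
  [⟨2 * c.2, c.1.2, if c.1.2 then -1 else 1⟩, ⟨2 * c.2 + 1, !c.1.2, if c.1.2 then -1 else 1⟩]

/-- The other endpoints of the arrows of a clasp. -/
def upper (c : (ℕ × Bool) × ℕ) : List Endpoint := (lower c).map Endpoint.opp

/-- The endpoints on the first strand of a product of clasps. -/
def strand₁ (C : List ((ℕ × Bool) × ℕ)) : List Endpoint :=
  C.flatMap fun c => if c.1.1 = 0 then [] else lower c

/-- The endpoints on the second strand of a product of clasps. -/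
def strand₂ (C : List ((ℕ × Bool) × ℕ)) : List Endpoint :=
  C.flatMap fun c => if c.1.1 = 0 then lower c else upper c

/-- The endpoints on the third strand of a product of clasps. -/
def strand₃ (C : List ((ℕ × Bool) × ℕ)) : List Endpoint :=
  C.flatMap fun c => if c.1.1 = 0 then upper c else []

/-- The long diagram that passes through a pure braid with three strands up, down and up. -/
def tangle (C : List ((ℕ × Bool) × ℕ)) : List Endpoint :=
  strand₁ C ++ (strand₂ C).reverse ++ strand₃ C

theorem tangle_perm (C : List ((ℕ × Bool) × ℕ)) :
    (tangle C).Perm (C.flatMap fun c => lower c ++ upper c) := by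
  rw [List.perm_iff_count]
  intro x
  induction C with
  | nil => simp [tangle, strand₁, strand₂, strand₃]
  | cons c C ih =>
    simp only [tangle, strand₁, strand₂, strand₃, List.count_append, List.flatMap_cons,
      List.count_reverse] at ih ⊢
    split_ifs <;> simp only [List.count_nil] <;> omega

theorem chord_of_mem_clasp {c : (ℕ × Bool) × ℕ} {e : Endpoint} (h : e ∈ lower c ++ upper c) :
    e.chord = 2 * c.2 ∨ e.chord = 2 * c.2 + 1 := by
  simp only [lower, upper, List.map_cons, List.map_nil, List.cons_append, List.nil_append,
    List.mem_cons, List.not_mem_nil, or_false] at h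
  rcases h with rfl | rfl | rfl | rfl <;> simp

theorem isGauss_clasp (c : (ℕ × Bool) × ℕ) : IsGauss (lower c ++ upper c) := by
  obtain ⟨⟨i, b⟩, k⟩ := c
  refine ⟨?_, ?_, ?_⟩
  · cases b <;> simp [lower, upper, Endpoint.opp]
  · intro a ha
    simp only [upper, List.mem_append, List.mem_map] at ha ⊢
    rcases ha with h | ⟨a', h, rfl⟩
    · exact Or.inr ⟨a, h, rfl⟩
    · exact Or.inl (by simpa using h)
  · intro a ha a' ha' _
    simp only [lower, upper, List.map_cons, List.map_nil, List.cons_append, List.nil_append,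
      List.mem_cons, List.not_mem_nil, or_false] at ha ha'
    rcases ha with rfl | rfl | rfl | rfl <;> rcases ha' with rfl | rfl | rfl | rfl <;> simp

theorem exists_mem_of_mem_tangle {C : List ((ℕ × Bool) × ℕ)} {e : Endpoint} (h : e ∈ tangle C) :
    ∃ c ∈ C, e ∈ lower c ++ upper c := by
  rw [(tangle_perm C).mem_iff, List.mem_flatMap] at h
  exact h

theorem isGauss_tangle {C : List ((ℕ × Bool) × ℕ)} (h : (C.map Prod.snd).Nodup) : IsGauss (tangle C) := by
  refine IsGauss.perm ?_ (tangle_perm C).symm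
  induction C with
  | nil => exact ⟨by simp, by simp, by simp⟩
  | cons c C ih =>
    rw [List.map_cons, List.nodup_cons] at h
    rw [List.flatMap_cons]
    refine (isGauss_clasp c).append (ih h.2) ?_
    intro a ha b hb hab
    obtain ⟨c', hc', hb⟩ := List.mem_flatMap.1 hb
    have h1 := chord_of_mem_clasp ha
    have h2 := chord_of_mem_clasp hb
    have : c'.2 = c.2 := by omega
    exact h.1 (List.mem_map.2 ⟨c', hc', this⟩)

/-- The names of the clasps are distinct, and their arrows do not occur in `D`. -/
structure Admissible (D : GaussDiagram) (C : List ((ℕ × Bool) × ℕ)) : Prop where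
  nodup : (C.map Prod.snd).Nodup
  fresh : ∀ c ∈ C, ∀ e ∈ D.word, e.chord < 2 * c.2

theorem Admissible.sublist {D : GaussDiagram} {C C' : List ((ℕ × Bool) × ℕ)} (h : Admissible D C)
    (hs : C'.Sublist C) : Admissible D C' :=
  ⟨h.nodup.sublist (hs.map _), fun c hc => h.fresh c (hs.subset hc)⟩

/-- The product of a long diagram and the tangle of a list of clasps. -/
def insertTangle (D : GaussDiagram) (C : List ((ℕ × Bool) × ℕ)) (h : Admissible D C) : GaussDiagram :=
  ofWord (D.word ++ tangle C) (D.isGauss_word.append (isGauss_tangle h.nodup) (by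
    intro a ha b hb hab
    obtain ⟨c, hc, hb⟩ := exists_mem_of_mem_tangle hb
    have h1 := h.fresh c hc a ha
    have h2 := chord_of_mem_clasp hb
    omega))

theorem insertTangle_word (D : GaussDiagram) (C : List ((ℕ × Bool) × ℕ)) (h : Admissible D C) :
    (insertTangle D C h).word = D.word ++ tangle C := rfl

theorem virtualize_word_of_r2 {E : GaussDiagram} {u v w : List Endpoint} {a b : Endpoint} {τ : ℤˣ}
    (hE : E.word = u ++ [a, b] ++ v ++ arrange τ a.opp b.opp ++ w) :
    (E.virtualize {a.chord, b.chord}).word = u ++ v ++ w := by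
  have hp : E.word.Perm (a :: a.opp :: b :: b.opp :: (u ++ v ++ w)) := hE ▸ r2_perm
  have hp' : E.word.Perm (b :: b.opp :: a :: a.opp :: (u ++ v ++ w)) := by
    refine hp.trans ?_
    rw [List.perm_iff_count]
    intro x
    simp only [List.count_cons]
    omega
  have hne : ∀ e ∈ u ++ v ++ w, e.chord ∉ ({a.chord, b.chord} : Finset ℕ) := fun e he => by
    rw [Finset.mem_insert, Finset.mem_singleton, not_or]
    exact ⟨E.chord_ne_of_perm hp e (List.mem_cons_of_mem _ (List.mem_cons_of_mem _ he)),
      E.chord_ne_of_perm hp' e (List.mem_cons_of_mem _ (List.mem_cons_of_mem _ he))⟩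
  have hu : u.filter (fun e => e.chord ∉ ({a.chord, b.chord} : Finset ℕ)) = u :=
    List.filter_eq_self.2 fun e he => decide_eq_true (hne e (by simp [he]))
  have hv : v.filter (fun e => e.chord ∉ ({a.chord, b.chord} : Finset ℕ)) = v :=
    List.filter_eq_self.2 fun e he => decide_eq_true (hne e (by simp [he]))
  have hw : w.filter (fun e => e.chord ∉ ({a.chord, b.chord} : Finset ℕ)) = w :=
    List.filter_eq_self.2 fun e he => decide_eq_true (hne e (by simp [he]))
  have ht : (arrange τ a.opp b.opp).filter (fun e => e.chord ∉ ({a.chord, b.chord} : Finset ℕ)) = [] := by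
    rw [List.filter_eq_nil_iff]
    intro e he
    rw [(arrange_perm _ _ _).mem_iff] at he
    simp only [List.mem_cons, List.not_mem_nil, or_false] at he
    rcases he with rfl | rfl <;> simp
  change E.word.filter _ = _
  rw [hE, List.filter_append, List.filter_append, List.filter_append, List.filter_append, hu, hv, hw, ht]
  simp

/-- Four crossings between antiparallel strands are undone from the inside outwards. The
intermediate diagram is taken as a virtualization of `E`, which makes it a Gauss diagram for free.
-/
theorem mk_eq_of_r2_r2 {D E : GaussDiagram} {u v w : List Endpoint} {p q r s : Endpoint}
    (hps : p.isOver = s.isOver) (hps' : p.sign = -s.sign) (hqr : q.isOver = r.isOver)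
    (hqr' : q.sign = -r.sign) (hD : D.word = u ++ v ++ w)
    (hE : E.word = u ++ [p, q, r, s] ++ v ++ [s.opp, r.opp, q.opp, p.opp] ++ w) :
    LongVirtualKnot.mk E = LongVirtualKnot.mk D := by
  have har : ∀ a b : Endpoint, arrange (-1) a b = [b, a] := fun a b => by simp [arrange]
  have h1 : E.word = (u ++ [p]) ++ [q, r] ++ ([s] ++ v ++ [s.opp]) ++ arrange (-1) q.opp r.opp ++
      ([p.opp] ++ w) := by
    rw [hE, har]
    simp
  have h2 := virtualize_word_of_r2 h1
  have h3 : (E.virtualize {q.chord, r.chord}).word =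
      u ++ [p, s] ++ v ++ arrange (-1) p.opp s.opp ++ w := by
    rw [h2, har]
    simp
  have m1 : Move (E.virtualize {q.chord, r.chord}) E := Move.r2 _ _ _ q r (-1) hqr hqr' h2 h1
  have m2 : Move D (E.virtualize {q.chord, r.chord}) := Move.r2 _ _ _ p s (-1) hps hps' hD h3
  exact (Quot.sound m1).symm.trans (Quot.sound m2).symm

theorem mk_insertTangle_cancel {D : GaussDiagram} {C₁ C₂ : List ((ℕ × Bool) × ℕ)} {i : ℕ} {b : Bool}
    {k k' : ℕ} (h : Admissible D (C₁ ++ ((i, b), k) :: ((i, !b), k') :: C₂))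
    (h' : Admissible D (C₁ ++ C₂)) :
    LongVirtualKnot.mk (insertTangle D _ h) = LongVirtualKnot.mk (insertTangle D _ h') := by
  have hs : ∀ b : Bool, (if b then (-1 : ℤˣ) else 1) = -(if (!b) then (-1 : ℤˣ) else 1) := by decide
  have hs' : ∀ b : Bool, (if (!b) then (-1 : ℤˣ) else 1) = -(if b then (-1 : ℤˣ) else 1) := by decide
  -- For `i = 0` the lower strand is the second one, which is read backwards, so the endpoints of
  -- the later clasp come first.
  by_cases hi : i = 0
  · refine mk_eq_of_r2_r2 (u := D.word ++ strand₁ C₁ ++ strand₁ C₂ ++ (strand₂ C₂).reverse)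
      (v := (strand₂ C₁).reverse ++ strand₃ C₁) (w := strand₃ C₂)
      (p := ⟨2 * k' + 1, b, if (!b) then -1 else 1⟩) (q := ⟨2 * k', !b, if (!b) then -1 else 1⟩)
      (r := ⟨2 * k + 1, !b, if b then -1 else 1⟩) (s := ⟨2 * k, b, if b then -1 else 1⟩)
      rfl (hs' b) rfl (hs' b) ?_ ?_
    · simp [insertTangle_word, tangle, strand₁, strand₂, strand₃]
    · simp [insertTangle_word, tangle, strand₁, strand₂, strand₃, hi, lower, upper]
  · refine mk_eq_of_r2_r2 (u := D.word ++ strand₁ C₁)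
      (v := strand₁ C₂ ++ (strand₂ C₂).reverse)
      (w := (strand₂ C₁).reverse ++ strand₃ C₁ ++ strand₃ C₂)
      (s := ⟨2 * k' + 1, b, if (!b) then -1 else 1⟩) (r := ⟨2 * k', !b, if (!b) then -1 else 1⟩)
      (q := ⟨2 * k + 1, !b, if b then -1 else 1⟩) (p := ⟨2 * k, b, if b then -1 else 1⟩)
      rfl (hs b) rfl (hs b) ?_ ?_
    · simp [insertTangle_word, tangle, strand₁, strand₂, strand₃]
    · simp [insertTangle_word, tangle, strand₁, strand₂, strand₃, hi, lower, upper]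

/-- Every reduction step removes two adjacent mutually inverse letters, that is, two cancelling
clasps. Only second Reidemeister moves occur. -/
theorem mk_insertTangle_of_red {D : GaussDiagram} {L : List (ℕ × Bool)} (hL : FreeGroup.Red L [])
    (C : List ((ℕ × Bool) × ℕ)) (hC : C.map Prod.fst = L) (h : Admissible D C) :
    LongVirtualKnot.mk (insertTangle D C h) = LongVirtualKnot.mk D := by
  induction hL using Relation.ReflTransGen.head_induction_on generalizing C with
  | refl =>
    obtain rfl := List.map_eq_nil_iff.1 hC
    congr 1
    ext1
    simp [insertTangle_word, tangle, strand₁, strand₂, strand₃]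
  | head hstep _ ih =>
    cases hstep with
    | @not L₁ L₂ x b =>
      obtain ⟨C₁, C', rfl, rfl, hC'⟩ := List.map_eq_append_iff.1 hC
      obtain ⟨⟨_, k⟩, C'', rfl, rfl, hC''⟩ := List.map_eq_cons_iff.1 hC'
      obtain ⟨⟨_, k'⟩, C₂, rfl, rfl, rfl⟩ := List.map_eq_cons_iff.1 hC''
      have h' : Admissible D (C₁ ++ C₂) := h.sublist
        (List.Sublist.append (List.Sublist.refl _)
          ((List.sublist_cons_self _ _).trans (List.sublist_cons_self _ _)))
      rw [mk_insertTangle_cancel h h']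
      exact ih (C₁ ++ C₂) (by simp) h'

theorem mk_insertTangle {D : GaussDiagram} (C : List ((ℕ × Bool) × ℕ))
    (hC : FreeGroup.mk (C.map Prod.fst) = 1) (h : Admissible D C) :
    LongVirtualKnot.mk (insertTangle D C h) = LongVirtualKnot.mk D := by
  rw [FreeGroup.one_eq_mk, FreeGroup.Red.exact] at hC
  obtain ⟨L, h1, h2⟩ := hC
  rw [FreeGroup.Red.nil_iff] at h2
  subst h2
  exact mk_insertTangle_of_red h1 C rfl h

/-- The arrows of the clasps with label `i`. -/
def labelChords (C : List ((ℕ × Bool) × ℕ)) (i : ℕ) : Finset ℕ :=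
  ((C.filter fun c => c.1.1 = i).flatMap fun c => [2 * c.2, 2 * c.2 + 1]).toFinset

theorem mem_labelChords {C : List ((ℕ × Bool) × ℕ)} {i x : ℕ} :
    x ∈ labelChords C i ↔ ∃ c ∈ C, c.1.1 = i ∧ (x = 2 * c.2 ∨ x = 2 * c.2 + 1) := by
  simp only [labelChords, List.mem_toFinset, List.mem_flatMap, List.mem_filter, decide_eq_true_eq,
    List.mem_cons, List.not_mem_nil, or_false, and_assoc]

theorem labelChords_subset {D : GaussDiagram} {C : List ((ℕ × Bool) × ℕ)} (h : Admissible D C) (i : ℕ) :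
    labelChords C i ⊆ (insertTangle D C h).chords := by
  intro x hx
  obtain ⟨c, hc, -, hx⟩ := mem_labelChords.1 hx
  rw [mem_chords]
  have hmem : ∀ e ∈ lower c, e ∈ (insertTangle D C h).word := by
    intro e he
    rw [insertTangle_word, List.mem_append, (tangle_perm C).mem_iff, List.mem_flatMap]
    exact Or.inr ⟨c, hc, List.mem_append_left _ he⟩
  rcases hx with rfl | rfl
  · exact ⟨_, hmem _ (List.mem_cons_self), rfl⟩
  · exact ⟨_, hmem _ (List.mem_cons_of_mem _ List.mem_cons_self), rfl⟩

theorem Admissible.eq_of_chord {D : GaussDiagram} {C : List ((ℕ × Bool) × ℕ)} (h : Admissible D C)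
    {c c' : (ℕ × Bool) × ℕ} (hc : c ∈ C) (hc' : c' ∈ C) {x : ℕ} (hx : x = 2 * c.2 ∨ x = 2 * c.2 + 1)
    (hx' : x = 2 * c'.2 ∨ x = 2 * c'.2 + 1) : c = c' :=
  List.inj_on_of_nodup_map h.nodup hc hc' (by omega)

theorem pairwise_disjoint_labelChords {D : GaussDiagram} {C : List ((ℕ × Bool) × ℕ)}
    (h : Admissible D C) : Pairwise fun i j => Disjoint (labelChords C i) (labelChords C j) := by
  intro i j hij
  rw [Finset.disjoint_left]
  intro x hxi hxj
  obtain ⟨c, hc, rfl, hx⟩ := mem_labelChords.1 hxi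
  obtain ⟨c', hc', rfl, hx'⟩ := mem_labelChords.1 hxj
  exact hij (by rw [h.eq_of_chord hc hc' hx hx'])

/-- Names of clasps are distinct and fresh, so an arrow determines its clasp: a clasp disappears as
a whole or is untouched. -/
theorem virtualize_insertTangle {D : GaussDiagram} {C : List ((ℕ × Bool) × ℕ)} (h : Admissible D C)
    (S : Finset ℕ) :
    (insertTangle D C h).virtualize (S.biUnion (labelChords C)) =
      insertTangle D (C.filter fun c => c.1.1 ∉ S) (h.sublist List.filter_sublist) := by
  have hmem : ∀ c ∈ C, ∀ x, (x = 2 * c.2 ∨ x = 2 * c.2 + 1) →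
      (x ∈ S.biUnion (labelChords C) ↔ c.1.1 ∈ S) := by
    intro c hc x hx
    simp only [Finset.mem_biUnion, mem_labelChords]
    constructor
    · rintro ⟨i, hi, c', hc', rfl, hx'⟩
      rwa [h.eq_of_chord hc hc' hx hx']
    · intro hS
      exact ⟨_, hS, c, hc, rfl, hx⟩
  have hclasp : ∀ c ∈ C, ∀ w, w ⊆ lower c ++ upper c →
      w.filter (fun e => e.chord ∉ S.biUnion (labelChords C)) = if c.1.1 ∉ S then w else [] := by
    intro c hc w hw
    by_cases hS : c.1.1 ∉ S
    · rw [if_pos hS]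
      exact List.filter_eq_self.2 fun e he => decide_eq_true
        (mt (hmem c hc _ (chord_of_mem_clasp (hw he))).1 hS)
    · rw [if_neg hS]
      refine List.filter_eq_nil_iff.2 fun e he => ?_
      rw [decide_eq_true_eq]
      exact not_not.2 ((hmem c hc _ (chord_of_mem_clasp (hw he))).2 (not_not.1 hS))
  have hstrand : ∀ f : (ℕ × Bool) × ℕ → List Endpoint, (∀ c, f c ⊆ lower c ++ upper c) →
      (C.flatMap f).filter (fun e => e.chord ∉ S.biUnion (labelChords C)) =
        (C.filter fun c => c.1.1 ∉ S).flatMap f := by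
    intro f hf
    clear h hmem
    generalize S.biUnion (labelChords C) = T at *
    induction C with
    | nil => rfl
    | cons c C ih =>
      rw [List.flatMap_cons, List.filter_append, hclasp c (by simp) _ (hf c),
        ih fun c hc => hclasp c (by simp [hc]), List.filter_cons]
      by_cases hS : c.1.1 ∈ S <;> simp [hS]
  ext1
  have hDw : D.word.filter (fun e => e.chord ∉ S.biUnion (labelChords C)) = D.word := by
    refine List.filter_eq_self.2 fun e he => decide_eq_true ?_
    rw [Finset.mem_biUnion]
    rintro ⟨i, -, hi⟩
    obtain ⟨c, hc, -, hx⟩ := mem_labelChords.1 hi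
    have := h.fresh c hc e he
    omega
  change List.filter _ (D.word ++ (strand₁ C ++ (strand₂ C).reverse ++ strand₃ C)) =
    D.word ++ (strand₁ _ ++ (strand₂ _).reverse ++ strand₃ _)
  rw [List.filter_append, List.filter_append, List.filter_append, List.filter_reverse, hDw]
  unfold strand₁ strand₂ strand₃
  rw [hstrand, hstrand, hstrand]
  · intro c
    split_ifs <;> simp
  · intro c
    split_ifs <;> simp
  · intro c
    split_ifs <;> simp

/-! ### Iterated commutators and invariants of bounded order. -/

/-- The endomorphism of a free group that kills the generators in `S`. -/
def kill (S : Finset ℕ) : FreeGroup ℕ →* FreeGroup ℕ :=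
  FreeGroup.lift fun i => if i ∈ S then 1 else FreeGroup.of i

theorem mk_filter (S : Finset ℕ) (L : List (ℕ × Bool)) :
    FreeGroup.mk (L.filter fun x => x.1 ∉ S) = kill S (FreeGroup.mk L) := by
  induction L with
  | nil => exact (map_one (kill S)).symm
  | cons x L ih =>
    obtain ⟨i, b⟩ := x
    have hm : ∀ (x : ℕ × Bool) L, FreeGroup.mk (x :: L) = FreeGroup.mk [x] * FreeGroup.mk L :=
      fun x L => rfl
    rw [hm, map_mul, ← ih, List.filter_cons]
    by_cases hi : i ∈ S
    · cases b <;> simp [hi, kill]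
    · have : kill S (FreeGroup.mk [(i, b)]) = FreeGroup.mk [(i, b)] := by
        cases b
        · simp [kill, hi, FreeGroup.of, FreeGroup.invRev]
        · simp [kill, hi, FreeGroup.of]
      simp only [hi, not_false_iff, decide_true, if_true]
      rw [hm, this]

open scoped commutatorElement in
/-- An iterated commutator in which all the generators up to `n` occur. -/
def iteratedCommutator : ℕ → FreeGroup ℕ
  | 0 => FreeGroup.of 0
  | n + 1 => ⁅iteratedCommutator n, FreeGroup.of (n + 1)⁆

theorem kill_iteratedCommutator {S : Finset ℕ} {i n : ℕ} (hi : i ∈ S) (hn : i ≤ n) :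
    kill S (iteratedCommutator n) = 1 := by
  induction n with
  | zero =>
    obtain rfl := Nat.le_zero.1 hn
    simp [iteratedCommutator, kill, hi]
  | succ n ih =>
    rw [iteratedCommutator, map_commutatorElement]
    rcases hn.eq_or_lt with rfl | h
    · simp [kill, hi]
    · simp [ih (Nat.lt_succ_iff.1 h)]

/-- The sets of crossings are those of the labels `0, …, m`. All of these occur in the commutator,
and a commutator with one entry killed is trivial, so virtualizing any nonempty union of them undoes
the whole tangle. -/
theorem eq_of_iteratedCommutator {G : Type*} [AddCommGroup G] {v : LongVirtualKnot → G} {m n : ℕ}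
    (hmn : m ≤ n) (hv : LongVirtualKnot.GPVOrderLE v m) {D : GaussDiagram} {C : List ((ℕ × Bool) × ℕ)}
    (h : Admissible D C) (hC : FreeGroup.mk (C.map Prod.fst) = iteratedCommutator n) :
    v (LongVirtualKnot.mk (insertTangle D C h)) = v (LongVirtualKnot.mk D) := by
  refine GPVOrderLE.eq_of_sets (v := fun D => v (LongVirtualKnot.mk D)) hv _ (labelChords C)
    (labelChords_subset h) (pairwise_disjoint_labelChords h) _ ?_
  intro S hS ⟨i, hi⟩
  have hin : i ≤ n := (Nat.lt_succ_iff.1 (Finset.mem_range.1 (hS hi))).trans hmn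
  rw [virtualize_insertTangle, mk_insertTangle]
  have : (C.filter fun c => c.1.1 ∉ S).map Prod.fst = (C.map Prod.fst).filter fun x => x.1 ∉ S := by
    rw [List.filter_map]
    rfl
  rw [this, mk_filter, hC, kill_iteratedCommutator hi hin]

end GaussDiagram

/-! ### Planarity of the diagrams with inserted tangles. -/

namespace GaussDiagram

theorem isGauss_of_perm {E : GaussDiagram} {b : Endpoint} {w : List Endpoint}
    (h : E.word.Perm (b :: b.opp :: w)) : IsGauss w := by
  have hne := E.chord_ne_of_perm h
  have hmem : ∀ e ∈ w, e ∈ E.word := fun e he => h.mem_iff.2 (by simp [he])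
  refine ⟨(h.nodup_iff.1 E.nodup).of_cons.of_cons, fun e he => ?_,
    fun e he e' he' => E.sign_eq e (hmem e he) e' (hmem e' he')⟩
  have h1 := h.mem_iff.1 (E.opp_mem e (hmem e he))
  simp only [List.mem_cons] at h1
  rcases h1 with h1 | h1 | h1
  · exact (hne e he (by simpa using congrArg Endpoint.chord h1)).elim
  · exact (hne e he (by simpa using congrArg Endpoint.chord h1)).elim
  · exact h1

theorem formPerm_of_isRotated_cons_cons (D : GaussDiagram) {x y : Endpoint} {l : List Endpoint}
    (h : D.word.IsRotated (x :: y :: l)) : D.word.formPerm x = y := by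
  rw [List.formPerm_eq_of_isRotated D.nodup h]
  exact List.formPerm_apply_head x y l (D.nodup_of_isRotated h)

/-- The faces of a diagram with two nested kinks. -/
theorem faces_of_nested_kinks {D E : GaussDiagram} {a b y : Endpoint} {l : List Endpoint}
    (hD : D.word.IsRotated (y :: l))
    (hE : E.word.IsRotated (a :: b :: b.opp :: a.opp :: y :: l)) :
    Nat.card E.Face = Nat.card D.Face + 2 ∧
      (¬ KeepsDirection a → KeepsDirection b → ∀ x, D.SameFace (y, false) x →
        E.SameFace (b.opp, false) x) := by
  have hE' : E.word.IsRotated (b :: b.opp :: a.opp :: (y :: l ++ [a])) := by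
    refine hE.trans ?_
    have := List.isRotated_append (l := [a]) (l' := b :: b.opp :: a.opp :: y :: l)
    simpa using this
  -- This word has the outer kink alone; it is written from `a.opp` on because the inner kink is
  -- inserted just before that endpoint.
  have hM : IsGauss (a.opp :: (y :: l ++ [a])) := isGauss_of_perm hE'.perm
  set M := ofWord _ hM with hMd
  have hM' : M.word.IsRotated (a :: a.opp :: y :: l) := by
    have := List.isRotated_append (l := a.opp :: y :: l) (l' := [a])
    simpa [hMd, ofWord] using this
  obtain ⟨h1, h2, h3, -⟩ := faces_of_r1 hD hM'
  obtain ⟨h4, h5, -, h6⟩ := faces_of_r1 (D := M) (E := E) (List.IsRotated.refl _) hE'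
  refine ⟨by omega, fun ka kb x hx => ?_⟩
  have h7 : M.word.formPerm.symm a.opp = a := by
    rw [Equiv.symm_apply_eq, M.formPerm_of_isRotated_cons_cons hM']
  rw [h7] at h6
  exact (h6 kb).symm.trans ((h5 _ _ (h3 ka)).symm.trans (h5 _ _ (h2 _ _ hx)))

/-- A clasp and its inverse differ by crossing changes, which alter both `isOver` and `sign` and so
do not affect `KeepsDirection`. Only this planar information enters the face count. -/
theorem lower_eq (c : (ℕ × Bool) × ℕ) : ∃ a b : Endpoint, lower c = [a, b] ∧ upper c = [a.opp, b.opp] ∧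
    ¬ KeepsDirection a ∧ KeepsDirection b := by
  obtain ⟨⟨i, s⟩, k⟩ := c
  refine ⟨_, _, rfl, rfl, ?_, ?_⟩ <;> cases s <;> simp [KeepsDirection]

/-- Clasps are added at the top. One of strands one and two consists of two nested kinks at the turn
from the first strand to the second. One of strands two and three joins the edge of this turn to the
edge that leaves the third strand, and gives two faces if both edges lie on a common face. The
second conclusion carries this fact along: `y` ends the edge of the turn, and `q` ends the outgoing
edge. -/
theorem faces_insertTangle {D : GaussDiagram} {q : Endpoint} {u : List Endpoint}
    (hD : D.word = q :: u) (C : List ((ℕ × Bool) × ℕ)) (h : Admissible D C) :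
    Nat.card (insertTangle D C h).Face = Nat.card D.Face + 2 * C.length ∧
      ∀ y l, (strand₂ C).reverse ++ strand₃ C ++ D.word = y :: l →
        (insertTangle D C h).SameFace (y, false) (q, false) := by
  induction C using List.reverseRecOn with
  | nil =>
    have h0 : insertTangle D [] h = D := by
      ext1
      simp [insertTangle_word, tangle, strand₁, strand₂, strand₃]
    rw [h0]
    refine ⟨by simp, fun y l hy => ?_⟩
    simp only [strand₂, strand₃, List.flatMap_nil, List.reverse_nil, List.nil_append, hD,
      List.cons.injEq] at hy
    rw [hy.1]
    exact SameFace.refl (by simp [hD, hy.1])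
  | append_singleton C c ih =>
    have h' : Admissible D C := h.sublist (List.sublist_append_left _ _)
    obtain ⟨ih1, ih2⟩ := ih h'
    obtain ⟨a, b, hl, hu, ka, kb⟩ := lower_eq c
    have hDw : (insertTangle D C h').word =
        (q :: u ++ strand₁ C) ++ ((strand₂ C).reverse ++ strand₃ C) := by
      simp [insertTangle_word, tangle, hD]
    by_cases hc : c.1.1 = 0
    · have hEw : (insertTangle D (C ++ [c]) h).word = (q :: u ++ strand₁ C) ++
          (b :: a :: ((strand₂ C).reverse ++ strand₃ C) ++ [a.opp, b.opp]) := by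
        simp [insertTangle_word, tangle, strand₁, strand₂, strand₃, hc, hl, hu, hD]
      have hnew : ∀ y l, (strand₂ (C ++ [c])).reverse ++ strand₃ (C ++ [c]) ++ D.word = y :: l →
          y = b := by
        intro y l hy
        simp [strand₂, strand₃, hc, hl] at hy
        exact hy.1.symm
      have hErot : (insertTangle D (C ++ [c]) h).word.IsRotated
          (b :: a :: ((strand₂ C).reverse ++ strand₃ C) ++ a.opp :: b.opp :: (q :: (u ++ strand₁ C))) := by
        rw [hEw]
        refine List.isRotated_append.trans ?_
        simp [List.IsRotated.refl]
      -- The word is empty only for the first clasp. Then the two edges coincide, and the clasp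
      -- consists of nested kinks.
      rcases hv : (strand₂ C).reverse ++ strand₃ C with _ | ⟨y, v⟩
      · rw [hv] at hErot hDw
        have hDrot : (insertTangle D C h').word.IsRotated (q :: (u ++ strand₁ C)) := by
          rw [hDw]
          simp [List.IsRotated.refl]
        obtain ⟨h1, -⟩ := faces_of_nested_kinks (a := b) (b := a) hDrot (by simpa using hErot)
        refine ⟨by simp only [List.length_append, List.length_singleton]; omega, fun y l hy => ?_⟩
        obtain rfl := hnew y l hy
        have hq : (insertTangle D (C ++ [c]) h).word.formPerm y.opp = q := by
          refine formPerm_of_isRotated_cons_cons _ (l := u ++ strand₁ C ++ [y, a, a.opp]) ?_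
          refine hErot.trans ?_
          have := List.isRotated_append (l := [y, a, a.opp]) (l' := y.opp :: q :: (u ++ strand₁ C))
          simpa using this
        have hqm : q ∈ (insertTangle D (C ++ [c]) h).word := by
          rw [insertTangle_word, hD]
          simp
        have hs := (insertTangle D (C ++ [c]) h).sameFace_step (x := (q, false)) hqm
        have hs' : (insertTangle D (C ++ [c]) h).step (q, false) = (y, false) := by
          rw [step_false, (Equiv.symm_apply_eq _).2 hq.symm,
            turn_of_not_keepsDirection (fun h => keepsDirection_opp.1 h kb), Endpoint.opp_opp]
          rfl
        rw [hs'] at hs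
        exact hs.symm
      · rw [hv] at hErot hDw
        have hDrot : (insertTangle D C h').word.IsRotated (y :: v ++ q :: (u ++ strand₁ C)) := by
          rw [hDw]
          exact List.isRotated_append
        obtain ⟨h1, h2⟩ := faces_of_r2 hDrot hErot kb ka
          (ih2 y (v ++ D.word) (by rw [hv]; simp))
        refine ⟨by simp only [List.length_append, List.length_singleton]; omega, fun y l hy => ?_⟩
        obtain rfl := hnew y l hy
        exact h2.symm
    · obtain ⟨y, l, hy⟩ : ∃ y l, (strand₂ C).reverse ++ strand₃ C ++ D.word = y :: l := by
        refine List.exists_cons_of_ne_nil ?_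
        simp [hD]
      have hDrot : (insertTangle D C h').word.IsRotated (y :: (l ++ strand₁ C)) := by
        rw [← List.cons_append, ← hy, hDw, hD]
        refine List.isRotated_append.trans ?_
        simp [List.IsRotated.refl]
      have hErot : (insertTangle D (C ++ [c]) h).word.IsRotated
          (a :: b :: b.opp :: a.opp :: y :: (l ++ strand₁ C)) := by
        rw [← List.cons_append, ← hy]
        have : (insertTangle D (C ++ [c]) h).word = (D.word ++ strand₁ C) ++
            (a :: b :: b.opp :: a.opp :: ((strand₂ C).reverse ++ strand₃ C)) := by
          simp [insertTangle_word, tangle, strand₁, strand₂, strand₃, hc, hl, hu]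
        rw [this]
        refine List.isRotated_append.trans ?_
        simp [List.IsRotated.refl]
      obtain ⟨h1, h2⟩ := faces_of_nested_kinks hDrot hErot
      refine ⟨by simp only [List.length_append, List.length_singleton]; omega, fun y' l' hy' => ?_⟩
      have : y' = b.opp := by
        simp [strand₂, strand₃, hc, hu] at hy'
        exact hy'.1.symm
      rw [this]
      exact h2 ka kb _ (ih2 y l hy)

theorem length_tangle (C : List ((ℕ × Bool) × ℕ)) : (tangle C).length = 4 * C.length := by
  rw [(tangle_perm C).length_eq]
  induction C with
  | nil => rfl
  | cons c C ih =>
    rw [List.flatMap_cons, List.length_append, ih]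
    simp only [lower, upper, List.length_append, List.length_map, List.length_cons, List.length_nil]
    omega

theorem isPlanar_insertTangle {D : GaussDiagram} (hD : D.word ≠ []) (hp : D.IsPlanar)
    (C : List ((ℕ × Bool) × ℕ)) (h : Admissible D C) : (insertTangle D C h).IsPlanar := by
  obtain ⟨q, u, hq⟩ := List.exists_cons_of_ne_nil hD
  have hne : (insertTangle D C h).word ≠ [] := by
    rw [insertTangle_word, hq]
    simp
  rw [isPlanar_iff _ hD] at hp
  rw [isPlanar_iff _ hne, (faces_insertTangle hq C h).1, insertTangle_word, List.length_append,
    length_tangle]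
  omega

end GaussDiagram

/-! ### The Burau representation at `-1` and colorings of tangles. -/

namespace GaussDiagram

open scoped MatrixGroups

/-- The reduced Burau representation at `-1` of the braids given by the clasps, acting on row
vectors. -/
def burau : FreeGroup ℕ →* SL(2, ℤ) :=
  FreeGroup.lift fun i =>
    if i = 0 then ⟨!![1, 0; 2, 1], by simp⟩ else ⟨!![1, -2; 0, 1], by simp⟩

theorem burau_zero (b : Bool) :
    (burau (FreeGroup.mk [(0, b)]) : Matrix (Fin 2) (Fin 2) ℤ) = !![1, 0; if b then 2 else -2, 1] := by
  cases b <;> simp [burau, Matrix.SpecialLinearGroup.SL2_inv_expl] <;> rfl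

theorem burau_ne_zero {i : ℕ} (hi : i ≠ 0) (b : Bool) :
    (burau (FreeGroup.mk [(i, b)]) : Matrix (Fin 2) (Fin 2) ℤ) = !![1, if b then -2 else 2; 0, 1] := by
  cases b <;> simp [burau, hi, Matrix.SpecialLinearGroup.SL2_inv_expl] <;> rfl

/-- The conjugate of a transvection by `g` depends only on the first column of `g`, and the upper
unitriangular factor on the right leaves the first column of the product alone. Hence there is a
recursion for first columns. -/
theorem burau_commutator (g : FreeGroup ℕ) {i : ℕ} (hi : i ≠ 0) :
    (burau (g * FreeGroup.of i * g⁻¹ * (FreeGroup.of i)⁻¹)) 0 0 = 1 + 2 * burau g 0 0 * burau g 1 0 ∧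
    (burau (g * FreeGroup.of i * g⁻¹ * (FreeGroup.of i)⁻¹)) 1 0 = 2 * burau g 1 0 ^ 2 := by
  have hdet := (burau g).det_coe
  rw [Matrix.det_fin_two] at hdet
  have h1 : (burau (FreeGroup.of i) : Matrix (Fin 2) (Fin 2) ℤ) = !![1, -2; 0, 1] := by
    simp [burau, hi]
  simp only [map_mul, map_inv, Matrix.SpecialLinearGroup.coe_mul, Matrix.SpecialLinearGroup.coe_inv,
    h1, Matrix.adjugate_fin_two, Matrix.mul_apply, Fin.sum_univ_two, Matrix.of_apply,
    Matrix.cons_val', Matrix.cons_val_zero, Matrix.cons_val_one, Matrix.cons_val_fin_one]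
  constructor
  · linear_combination hdet
  · ring

/-- The recursion `(a, c) ↦ (1 + 2ac, 2c²)`, started at `(1, 2)`, keeps both entries positive. The
bound `3` makes the corner entry usable as a modulus. -/
theorem burau_iteratedCommutator (n : ℕ) :
    1 ≤ burau (iteratedCommutator n) 0 0 ∧ 1 ≤ burau (iteratedCommutator n) 1 0 ∧
      (1 ≤ n → 3 ≤ burau (iteratedCommutator n) 0 0) := by
  induction n with
  | zero => simp [iteratedCommutator, burau]
  | succ n ih =>
    obtain ⟨h1, h2, -⟩ := ih
    obtain ⟨e1, e2⟩ := burau_commutator (iteratedCommutator n) (Nat.succ_ne_zero n)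
    rw [iteratedCommutator, commutatorElement_def, e1, e2]
    refine ⟨?_, ?_, fun _ => ?_⟩ <;> nlinarith

section Coloring

variable {R : Type*} [CommRing R]

/-- The colors `s`, `t` are those of the strand that is on top at the first and at the second
crossing. They are fixed before `h`, so that they can be written into a coloring of the remaining
clasps. -/
theorem run_clasp (i : ℕ) (b : Bool) (k : ℕ) (p q : R) : ∃ s t : R, ∀ h : ℕ → R, h (2 * k) = s →
    h (2 * k + 1) = t →
    Run h p (lower ((i, b), k)) (if b then 3 * p - 2 * q else 2 * q - p) ∧
      Run h q (upper ((i, b), k)) (if b then 2 * p - q else 3 * q - 2 * p) := by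
  cases b
  · refine ⟨q, 2 * q - p, fun h hs ht => ?_⟩
    simp only [lower, upper, List.map_cons, List.map_nil, Run, Pass, Endpoint.opp, Bool.not_true,
      Bool.not_false, Bool.false_eq_true, if_false, if_true, hs, ht]
    exact ⟨⟨2 * q - p, by ring, _, ⟨rfl, rfl⟩, rfl⟩, ⟨q, ⟨rfl, trivial⟩, _, by ring, rfl⟩⟩
  · refine ⟨p, 2 * p - q, fun h hs ht => ?_⟩
    simp only [lower, upper, List.map_cons, List.map_nil, Run, Pass, Endpoint.opp, Bool.not_true,
      Bool.not_false, Bool.false_eq_true, if_false, if_true, hs, ht]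
    exact ⟨⟨p, ⟨rfl, trivial⟩, _, by ring, rfl⟩, ⟨2 * p - q, by ring, _, ⟨rfl, rfl⟩, rfl⟩⟩

theorem mem_tangle_of_mem_strand {C : List ((ℕ × Bool) × ℕ)} {e : Endpoint}
    (h : e ∈ strand₁ C ∨ e ∈ strand₂ C ∨ e ∈ strand₃ C) : e ∈ tangle C := by
  simp only [tangle, List.mem_append, List.mem_reverse]
  tauto

/-- Arbitrary colors at the bottom propagate upwards. A clasp preserves the alternating sum of the
colors and acts on the row vector `(x₁ - x₂, x₃ - x₂)` from the right by its Burau matrix. -/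
theorem exists_run_strands (C : List ((ℕ × Bool) × ℕ)) (hC : (C.map Prod.snd).Nodup) (x₁ x₂ x₃ : R) :
    ∃ (h : ℕ → R) (y₁ y₂ y₃ : R), Run h x₁ (strand₁ C) y₁ ∧ Run h x₂ (strand₂ C) y₂ ∧
      Run h x₃ (strand₃ C) y₃ ∧ y₁ - y₂ + y₃ = x₁ - x₂ + x₃ ∧
      (y₁ - y₂ = (x₁ - x₂) * (burau (FreeGroup.mk (C.map Prod.fst)) 0 0 : ℤ) +
        (x₃ - x₂) * (burau (FreeGroup.mk (C.map Prod.fst)) 1 0 : ℤ)) ∧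
      (y₃ - y₂ = (x₁ - x₂) * (burau (FreeGroup.mk (C.map Prod.fst)) 0 1 : ℤ) +
        (x₃ - x₂) * (burau (FreeGroup.mk (C.map Prod.fst)) 1 1 : ℤ)) := by
  induction C generalizing x₁ x₂ x₃ with
  | nil =>
    refine ⟨0, x₁, x₂, x₃, rfl, rfl, rfl, rfl, ?_⟩
    have : burau (FreeGroup.mk (([] : List ((ℕ × Bool) × ℕ)).map Prod.fst)) = 1 := map_one burau
    rw [this]
    simp
  | cons c C ih =>
    obtain ⟨⟨i, b⟩, k⟩ := c
    rw [List.map_cons, List.nodup_cons] at hC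
    have hfresh : ∀ e ∈ tangle C, e.chord ≠ 2 * k ∧ e.chord ≠ 2 * k + 1 := by
      intro e he
      obtain ⟨c', hc', he⟩ := exists_mem_of_mem_tangle he
      have h1 := chord_of_mem_clasp he
      have h2 : c'.2 ≠ k := fun h => hC.1 (List.mem_map.2 ⟨c', hc', h⟩)
      omega
    have hup : ∀ (h : ℕ → R) (s t : R) w, (∀ e ∈ w, e ∈ tangle C) → ∀ x y, Run h x w y →
        Run (Function.update (Function.update h (2 * k) s) (2 * k + 1) t) x w y := by
      intro h s t w hw x y hr
      refine (run_congr fun e he => ?_).2 hr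
      obtain ⟨h1, h2⟩ := hfresh e (hw e he)
      rw [Function.update_of_ne h2, Function.update_of_ne h1]
    have hm : burau (FreeGroup.mk ((((i, b), k) :: C).map Prod.fst)) =
        burau (FreeGroup.mk [(i, b)]) * burau (FreeGroup.mk (C.map Prod.fst)) := by
      rw [← map_mul]
      rfl
    rw [hm]
    simp only [Matrix.SpecialLinearGroup.coe_mul, Matrix.mul_apply, Fin.sum_univ_two]
    by_cases hi : i = 0
    · subst hi
      obtain ⟨s, t, hst⟩ := run_clasp 0 b k x₂ x₃
      obtain ⟨h, y₁, y₂, y₃, r₁, r₂, r₃, e₁, e₂, e₃⟩ := ih hC.2 x₁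
        (if b then 3 * x₂ - 2 * x₃ else 2 * x₃ - x₂) (if b then 2 * x₂ - x₃ else 3 * x₃ - 2 * x₂)
      obtain ⟨c₁, c₂⟩ := hst (Function.update (Function.update h (2 * k) s) (2 * k + 1) t)
        (by rw [Function.update_of_ne (by omega), Function.update_self]) (Function.update_self _ _ _)
      refine ⟨Function.update (Function.update h (2 * k) s) (2 * k + 1) t, y₁, y₂, y₃,
        ?_, ?_, ?_, ?_, ?_, ?_⟩
      · exact hup h s t _ (fun e he => mem_tangle_of_mem_strand (Or.inl he)) _ _ r₁
      · exact run_append.2 ⟨_, c₁,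
          hup h s t _ (fun e he => mem_tangle_of_mem_strand (Or.inr (Or.inl he))) _ _ r₂⟩
      · exact run_append.2 ⟨_, c₂,
          hup h s t _ (fun e he => mem_tangle_of_mem_strand (Or.inr (Or.inr he))) _ _ r₃⟩
      · rw [e₁]
        cases b <;> simp <;> ring
      · rw [e₂, burau_zero]
        cases b <;> simp <;> ring
      · rw [e₃, burau_zero]
        cases b <;> simp <;> ring
    · obtain ⟨s, t, hst⟩ := run_clasp i b k x₁ x₂
      obtain ⟨h, y₁, y₂, y₃, r₁, r₂, r₃, e₁, e₂, e₃⟩ := ih hC.2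
        (if b then 3 * x₁ - 2 * x₂ else 2 * x₂ - x₁) (if b then 2 * x₁ - x₂ else 3 * x₂ - 2 * x₁) x₃
      obtain ⟨c₁, c₂⟩ := hst (Function.update (Function.update h (2 * k) s) (2 * k + 1) t)
        (by rw [Function.update_of_ne (by omega), Function.update_self]) (Function.update_self _ _ _)
      have d₁ : strand₁ (((i, b), k) :: C) = lower ((i, b), k) ++ strand₁ C := by simp [strand₁, hi]
      have d₂ : strand₂ (((i, b), k) :: C) = upper ((i, b), k) ++ strand₂ C := by simp [strand₂, hi]
      have d₃ : strand₃ (((i, b), k) :: C) = strand₃ C := by simp [strand₃, hi]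
      rw [d₁, d₂, d₃]
      refine ⟨Function.update (Function.update h (2 * k) s) (2 * k + 1) t, y₁, y₂, y₃,
        ?_, ?_, ?_, ?_, ?_, ?_⟩
      · exact run_append.2 ⟨_, c₁,
          hup h s t _ (fun e he => mem_tangle_of_mem_strand (Or.inl he)) _ _ r₁⟩
      · exact run_append.2 ⟨_, c₂,
          hup h s t _ (fun e he => mem_tangle_of_mem_strand (Or.inr (Or.inl he))) _ _ r₂⟩
      · exact hup h s t _ (fun e he => mem_tangle_of_mem_strand (Or.inr (Or.inr he))) _ _ r₃
      · rw [e₁]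
        cases b <;> simp <;> ring
      · rw [e₂, burau_ne_zero hi]
        cases b <;> simp <;> ring
      · rw [e₃, burau_ne_zero hi]
        cases b <;> simp <;> ring

theorem eq_zero_of_run {h : ℕ → R} {w : List Endpoint} (hw : ∀ e ∈ w, h e.chord = 0) {y : R}
    (hr : Run h 0 w y) : y = 0 :=
  hr.unique ((run_congr (h := h) (h' := fun _ => 0) hw).2 (run_const w 0))

/-- A nontrivial coloring of the tangle with color zero at both ends. -/
theorem exists_run_tangle [Nontrivial R] (C : List ((ℕ × Bool) × ℕ)) (hC : (C.map Prod.snd).Nodup)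
    (hb : ((burau (FreeGroup.mk (C.map Prod.fst)) 0 0 : ℤ) : R) = 0) :
    ∃ h : ℕ → R, Run h 0 (tangle C) 0 ∧ ∃ e ∈ tangle C, h e.chord ≠ 0 := by
  -- The long end has color `0`, and the second and third strands agree at the bottom turn. The
  -- difference vector is `(1, 0)`, so `y₁ - y₂` is the corner entry and vanishes; the alternating
  -- sum is zero, so `y₃ = 0`.
  obtain ⟨h, y₁, y₂, y₃, r₁, r₂, r₃, e₁, e₂, -⟩ := exists_run_strands C hC (0 : R) (-1) (-1)
  rw [hb] at e₂
  obtain rfl : y₁ = y₂ := by linear_combination e₂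
  obtain rfl : y₃ = 0 := by linear_combination e₁
  refine ⟨h, run_append.2 ⟨_, run_append.2 ⟨_, r₁, run_reverse.2 r₂⟩, r₃⟩, ?_⟩
  -- If all crossing colors were zero, color zero would persist along the first strand and back down
  -- the second, which has color `-1` at the bottom.
  by_contra! hcon
  have h0 := eq_zero_of_run (fun e he => hcon e (mem_tangle_of_mem_strand (Or.inl he))) r₁
  rw [h0, ← run_reverse] at r₂
  have h1 := eq_zero_of_run
    (fun e he => hcon e (mem_tangle_of_mem_strand (Or.inr (Or.inl (List.mem_reverse.1 he))))) r₂
  exact one_ne_zero (neg_eq_zero.1 h1)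

/-- The colorings with color zero at the base point. -/
def basedColorings (R : Type*) [CommRing R] (w : List Endpoint) : Set (ℕ → R) :=
  {h | (0, h) ∈ colorings R w}

theorem finite_basedColorings [Finite R] (w : List Endpoint) : (basedColorings R w).Finite :=
  (finite_colorings w).preimage (Prod.mk_right_injective 0).injOn

theorem ncard_basedColorings_le [Finite R] (w : List Endpoint) :
    (basedColorings R w).ncard ≤ (colorings R w).ncard :=
  Set.ncard_le_ncard_of_injOn (Prod.mk 0) (fun _ h => h) (Prod.mk_right_injective 0).injOn
    (finite_colorings w)

/-- A coloring of `D` with base color zero extends over the tangle by zero or by the nontrivial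
coloring `k`. The two families are disjoint because they differ at `e₀`. -/
theorem ncard_basedColorings_insertTangle [Finite R] [Nontrivial R] {D : GaussDiagram}
    {C : List ((ℕ × Bool) × ℕ)} (hC : Admissible D C)
    (hb : ((burau (FreeGroup.mk (C.map Prod.fst)) 0 0 : ℤ) : R) = 0) :
    2 * (basedColorings R D.word).ncard ≤ (basedColorings R (insertTangle D C hC).word).ncard := by
  classical
  obtain ⟨k, hk, e₀, he₀, hke₀⟩ := exists_run_tangle C hC.nodup hb
  have hdisj : ∀ a ∈ D.word, ∀ e ∈ tangle C, a.chord ≠ e.chord := by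
    intro a ha e he hae
    obtain ⟨c, hc, he⟩ := exists_mem_of_mem_tangle he
    have h1 := hC.fresh c hc a ha
    have h2 := chord_of_mem_clasp he
    omega
  set k' : ℕ → R := fun c => if c ∈ (tangle C).map Endpoint.chord then k c else 0 with hk'
  have hkt : ∀ e ∈ tangle C, k' e.chord = k e.chord := fun e he => if_pos (List.mem_map_of_mem he)
  have hkD : ∀ a ∈ D.word, k' a.chord = 0 := by
    intro a ha
    refine if_neg fun h => ?_
    obtain ⟨e, he, hea⟩ := List.mem_map.1 h
    exact hdisj a ha e he hea.symm
  have hzero : ∀ h ∈ basedColorings R D.word, ∀ e ∈ tangle C, h e.chord = 0 := by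
    intro h hh e he
    refine hh.1 e.chord fun hm => ?_
    obtain ⟨a, ha, hae⟩ := List.mem_map.1 hm
    exact hdisj a ha e he hae
  have hsub : ∀ h ∈ basedColorings R D.word, h ∈ basedColorings R (insertTangle D C hC).word := by
    intro h hh
    refine ⟨fun c hc => hh.1 c fun hm => hc ?_, run_append.2 ⟨0, hh.2, ?_⟩⟩
    · rw [insertTangle_word, List.map_append, List.mem_append]
      exact Or.inl hm
    · exact (run_congr (h := h) (h' := fun _ => 0) (hzero h hh)).2 (run_const _ 0)
  have hsub' : ∀ h ∈ basedColorings R D.word, h + k' ∈ basedColorings R (insertTangle D C hC).word := by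
    intro h hh
    refine ⟨fun c hc => ?_, run_append.2 ⟨0, ?_, ?_⟩⟩
    · rw [insertTangle_word, List.map_append, List.mem_append, not_or] at hc
      change h c + k' c = 0
      have h1 : h c = 0 := hh.1 c hc.1
      rw [h1, zero_add]
      exact if_neg hc.2
    · refine (run_congr fun a ha => ?_).2 hh.2
      change h a.chord + k' a.chord = h a.chord
      rw [hkD a ha, add_zero]
    · refine (run_congr fun e he => ?_).2 hk
      change h e.chord + k' e.chord = k e.chord
      rw [hzero h hh e he, hkt e he, zero_add]
  have hd : Disjoint (basedColorings R D.word) ((fun h => h + k') '' basedColorings R D.word) := by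
    rw [Set.disjoint_left]
    rintro _ hh ⟨h, hh', rfl⟩
    have h1 := hzero _ hh e₀ he₀
    have h2 := hzero _ hh' e₀ he₀
    change h e₀.chord + k' e₀.chord = 0 at h1
    rw [h2, zero_add, hkt e₀ he₀] at h1
    exact hke₀ h1
  have hfin := finite_basedColorings (R := R) D.word
  have hcard : ((fun h => h + k') '' basedColorings R D.word).ncard = (basedColorings R D.word).ncard :=
    Set.ncard_image_of_injective _ (add_left_injective k')
  rw [two_mul]
  nth_rw 2 [← hcard]
  rw [← Set.ncard_union_eq hd hfin (hfin.image _)]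
  refine Set.ncard_le_ncard ?_ (finite_basedColorings _)
  rintro h (hh | ⟨h, hh, rfl⟩)
  · exact hsub h hh
  · exact hsub' h hh

end Coloring

end GaussDiagram

/-! ### The sequence of connected sums. -/

namespace GaussDiagram

/-- The diagram with one crossing. -/
def kink : GaussDiagram := ofWord [⟨0, true, 1⟩, ⟨0, false, 1⟩] ⟨by simp, by simp [Endpoint.opp], by simp⟩

/-- Each half-edge at the over endpoint is a face by itself; the two at the under endpoint form the
third. -/
theorem card_face_kink : Nat.card kink.Face = 3 := by
  have hs : ∀ x : Endpoint × Bool, x.1 ∈ kink.word → kink.step x =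
      if x.1.isOver = true then x else (x.1, !x.2) := by
    intro x hx
    obtain ⟨e, s⟩ := x
    have hf : kink.word.formPerm = Equiv.swap ⟨0, true, 1⟩ ⟨0, false, 1⟩ := List.formPerm_pair _ _
    simp only [kink, ofWord, List.mem_cons, List.not_mem_nil, or_false] at hx
    rcases hx with rfl | rfl <;> cases s <;>
      simp [step, otherEnd, hf, turn, Endpoint.opp]
  let f : kink.Face → Fin 3 := Quot.lift
    (fun x => if x.1.1.isOver = true then (if x.1.2 = true then 0 else 1) else 2) (by
      rintro ⟨x, hx⟩ ⟨_, hy⟩ rfl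
      have := hs x hx
      unfold step at this
      simp only [this]
      split_ifs <;> simp_all)
  rw [← Nat.card_fin 3]
  refine Nat.card_congr (Equiv.ofBijective f ⟨?_, ?_⟩)
  · have hm : (⟨0, false, 1⟩ : Endpoint) ∈ kink.word := by simp [kink, ofWord]
    have h1 : kink.face (⟨0, false, 1⟩, true) hm = kink.face (⟨0, false, 1⟩, false) hm :=
      (kink.face_step (x := (⟨0, false, 1⟩, true)) hm).symm.trans (kink.face_congr _ (hs _ hm))
    rintro ⟨⟨⟨e, s⟩, hx⟩⟩ ⟨⟨⟨e', s'⟩, hx'⟩⟩ h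
    have hx₁ := hx
    have hx₂ := hx'
    simp only [kink, ofWord, List.mem_cons, List.not_mem_nil, or_false] at hx₁ hx₂
    rcases hx₁ with rfl | rfl <;> rcases hx₂ with rfl | rfl <;> cases s <;> cases s' <;>
      simp [f] at h <;> first | rfl | exact h1 | exact h1.symm
  · intro i
    fin_cases i
    · exact ⟨kink.face (⟨0, true, 1⟩, true) (by simp [kink, ofWord]), rfl⟩
    · exact ⟨kink.face (⟨0, true, 1⟩, false) (by simp [kink, ofWord]), rfl⟩
    · exact ⟨kink.face (⟨0, false, 1⟩, true) (by simp [kink, ofWord]), rfl⟩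

theorem isPlanar_kink : kink.IsPlanar := by
  rw [isPlanar_iff _ (by simp [kink, ofWord]), card_face_kink]
  rfl

/-- The diagram without crossings has no half-edges and is planar only by convention. A kink
replaces it, so that faces can be counted. -/
theorem exists_planar_ne_nil (D : GaussDiagram) (h : D.IsPlanar) :
    ∃ D' : GaussDiagram, D'.IsPlanar ∧ D'.word ≠ [] ∧ LongVirtualKnot.mk D' = LongVirtualKnot.mk D := by
  by_cases hD : D.word = []
  · refine ⟨kink, isPlanar_kink, by simp [kink, ofWord], ?_⟩
    exact (Quot.sound (Move.r1 [] [] ⟨0, true, 1⟩ hD rfl)).symm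
  · exact ⟨D, h, hD, rfl⟩

/-- The iterated commutator as a list of clasps whose arrows do not occur in `D`. -/
def freshClasps (n : ℕ) (D : GaussDiagram) : List ((ℕ × Bool) × ℕ) :=
  (iteratedCommutator n).toWord.zipIdx (D.chords.sup id + 1)

theorem freshClasps_fst (n : ℕ) (D : GaussDiagram) :
    FreeGroup.mk ((freshClasps n D).map Prod.fst) = iteratedCommutator n := by
  rw [freshClasps, List.zipIdx_map_fst, FreeGroup.mk_toWord]

theorem admissible_freshClasps (n : ℕ) (D : GaussDiagram) : Admissible D (freshClasps n D) := by
  have hs : (freshClasps n D).map Prod.snd =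
      List.range' (D.chords.sup id + 1) (iteratedCommutator n).toWord.length := by
    rw [freshClasps, List.zipIdx_map_snd]
  refine ⟨hs ▸ List.nodup_range', fun c hc e he => ?_⟩
  have h1 : c.2 ∈ (freshClasps n D).map Prod.snd := List.mem_map_of_mem hc
  rw [hs, List.mem_range'_1] at h1
  have h2 : e.chord ≤ D.chords.sup id := Finset.le_sup (f := id) (mem_chords.2 ⟨e, he, rfl⟩)
  omega

/-- The connected sums of `D` with a knot given by an iterated commutator. -/
def connectedSums (n : ℕ) (D : GaussDiagram) : ℕ → GaussDiagram
  | 0 => D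
  -- With `n + 1` the word is a genuine commutator even for `n = 0`, which the bound `3` on the
  -- corner entry requires.
  | l + 1 => insertTangle (connectedSums n D l) _ (admissible_freshClasps (n + 1) _)

theorem connectedSums_ne_nil (n : ℕ) {D : GaussDiagram} (h : D.word ≠ []) (l : ℕ) :
    (connectedSums n D l).word ≠ [] := by
  induction l with
  | zero => exact h
  | succ l ih =>
    rw [connectedSums, insertTangle_word]
    simp [ih]

theorem isPlanar_connectedSums (n : ℕ) {D : GaussDiagram} (h : D.word ≠ []) (hD : D.IsPlanar) (l : ℕ) :
    (connectedSums n D l).IsPlanar := by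
  induction l with
  | zero => exact hD
  | succ l ih => exact isPlanar_insertTangle (connectedSums_ne_nil n h l) ih _ _

theorem eq_connectedSums {G : Type*} [AddCommGroup G] {v : LongVirtualKnot → G} {m n : ℕ}
    (hmn : m + 1 ≤ n) (hv : LongVirtualKnot.GPVOrderLE v m) (D : GaussDiagram) (l : ℕ) :
    v (LongVirtualKnot.mk (connectedSums n D l)) = v (LongVirtualKnot.mk D) := by
  induction l with
  | zero => rfl
  | succ l ih =>
    rw [← ih]
    exact eq_of_iteratedCommutator (by omega) hv _ (freshClasps_fst (n + 1) _)

/-- The modulus is the corner entry of the Burau matrix of the commutator. It is the same for all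
summands, so the doublings accumulate. -/
theorem exists_unbounded_coloringNumber (n : ℕ) (D : GaussDiagram) :
    ∃ p : ℕ, ∀ l, 2 ^ l ≤ VirtualKnot.coloringNumber (ZMod p) (VirtualKnot.mk (connectedSums n D l)) := by
  obtain ⟨-, -, h3⟩ := burau_iteratedCommutator (n + 1)
  have h3 := h3 (by omega)
  obtain ⟨p, hp⟩ := Int.eq_ofNat_of_zero_le (by omega : 0 ≤ burau (iteratedCommutator (n + 1)) 0 0)
  have hp3 : 3 ≤ p := by omega
  have : NeZero p := ⟨by omega⟩
  have : Fact (1 < p) := ⟨by omega⟩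
  refine ⟨p, fun l => ?_⟩
  rw [VirtualKnot.coloringNumber_mk]
  refine le_trans ?_ (ncard_basedColorings_le _)
  induction l with
  | zero =>
    rw [pow_zero, Nat.one_le_iff_ne_zero, ← Nat.pos_iff_ne_zero,
      Set.ncard_pos (finite_basedColorings _)]
    exact ⟨fun _ => 0, fun _ _ => rfl, run_const _ 0⟩
  | succ l ih =>
    rw [pow_succ']
    refine (Nat.mul_le_mul_left 2 ih).trans (ncard_basedColorings_insertTangle _ ?_)
    rw [freshClasps_fst, hp]
    simp

theorem infinite_connectedSums (n : ℕ) (D : GaussDiagram) :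
    (Set.range fun l => VirtualKnot.mk (connectedSums n D l)).Infinite := by
  obtain ⟨p, hp⟩ := exists_unbounded_coloringNumber n D
  intro hfin
  obtain ⟨b, hb⟩ := (hfin.image (VirtualKnot.coloringNumber (ZMod p))).bddAbove
  have h1 := hb (Set.mem_image_of_mem _ (Set.mem_range_self b))
  exact absurd ((hp b).trans h1) (not_le.2 Nat.lt_two_pow_self)

end GaussDiagram

theorem exists_injective_of_infinite_range {α : Type*} {f : ℕ → α} (h : (Set.range f).Infinite) :
    ∃ φ : ℕ → ℕ, Function.Injective (f ∘ φ) := by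
  have := h.natEmbedding
  choose φ hφ using fun k => (this k).2
  refine ⟨φ, fun a b hab => this.injective (Subtype.ext ?_)⟩
  rw [← hφ a, ← hφ b]
  exact hab

theorem theorem1 (n : ℕ) :
    (∀ K : VirtualKnot, K.IsClassical →
      ∃ L : ℕ → VirtualKnot, Function.Injective L ∧ (∀ l, (L l).IsClassical) ∧
        ∀ m : ℕ, m + 1 ≤ n →
          ∀ (G : Type u) [AddCommGroup G] (v : VirtualKnot → G), VirtualKnot.GPVOrderLE v m →
            ∀ l, v (L l) = v K) ∧
    (∀ K : LongVirtualKnot, K.IsClassical →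
      ∃ L : ℕ → LongVirtualKnot, Function.Injective L ∧ (∀ l, (L l).IsClassical) ∧
        ∀ m : ℕ, m + 1 ≤ n →
          ∀ (G : Type u) [AddCommGroup G] (v : LongVirtualKnot → G),
            LongVirtualKnot.GPVOrderLE v m → ∀ l, v (L l) = v K) := by
  constructor
  · rintro K ⟨D₀, h₀, rfl⟩
    obtain ⟨D, hD, hne, hmk⟩ := D₀.exists_planar_ne_nil h₀
    obtain ⟨φ, hφ⟩ := exists_injective_of_infinite_range (GaussDiagram.infinite_connectedSums n D)
    refine ⟨_, hφ, fun l => ⟨_, GaussDiagram.isPlanar_connectedSums n hne hD _, rfl⟩,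
      fun m hm G _ v hv l => ?_⟩
    -- Composed with closing, an invariant of knots is an invariant of long knots with the same
    -- values on diagrams, hence of the same order.
    have := GaussDiagram.eq_connectedSums (v := fun K => v K.close) hm hv D (φ l)
    rw [hmk] at this
    exact this
  · rintro K ⟨D₀, h₀, rfl⟩
    obtain ⟨D, hD, hne, hmk⟩ := D₀.exists_planar_ne_nil h₀
    obtain ⟨φ, hφ⟩ := exists_injective_of_infinite_range (GaussDiagram.infinite_connectedSums n D)
    refine ⟨fun l => LongVirtualKnot.mk (GaussDiagram.connectedSums n D (φ l)),
      -- The long knots are distinct because their closures are.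
      fun a b hab => hφ (congrArg LongVirtualKnot.close hab),
      fun l => ⟨_, GaussDiagram.isPlanar_connectedSums n hne hD _, rfl⟩, fun m hm G _ v hv l => ?_⟩
    rw [← hmk]
    exact GaussDiagram.eq_connectedSums hm hv D (φ l)
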